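/- A hypergraph is a finite set of vertices together with a set of subsets of it, called edges; a $3$-graph is a hypergraph all of whose edges have size $3$. For $l\ge 3$, let $C_l^3$ denote the $3$-uniform loose cycle of length $l$: it has $l$ edges $e_1,\dots,e_l$ of size $3$, indexed cyclically, such that consecutive edges meet in exactly one vertex, distinct non-consecutive edges are disjoint, and no vertex lies in three of the edges (the last condition matters only for $l=3$). Let $K_n^3$ be the hypergraph on $n$ vertices whose edges are all the $3$-element sets of vertices. Let $R(C_l^3,K_n^3)$ be the least integer $N$ such that every colouring of the edges of $K_N^3$ red and blue contains a copy of $C_l^3$ all of whose edges are red or a copy of $K_n^3$ all of whose edges are blue. Theorem. For every fixed $l\ge 3$ there is a constant $c_{3,l}$ such that for all $n$ the number $R(C_l^3,K_n^3)$ exists and $$R(C_l^3,K_n^3)\le c_{3,l}\, n^{1+1/\lfloor (l+1)/2\rfloor}.$$ In particular, there is a constant $c_{3,5}$ with $R(C_5^3,K_n^3)\le c_{3,5}\,n^{4/3}$ for all $n$. Equivalently, for every fixed $l\ge 3$, with $m=\lfloor (l-1)/2\rfloor$, there is a constant $c>0$ such that every $3$-graph on $n$ vertices that contains no copy of $C_l^3$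 has a set of at least $c\,n^{(m+1)/(m+2)}$ vertices that contains no edge. -/

import Mathlib

namespace Hypergraph

variable {α : Type*}

/-- `H` is `r`-uniform: every edge has exactly `r` vertices. -/
def IsUniform (H : Hypergraph α) (r : ℕ) : Prop :=
  ∀ e ∈ H.edgeSet, e.encard = r

/-- The cyclic sequence `e` of `l` edges (`l ≥ 3`) forms a loose cycle: consecutive edges
meet in exactly one vertex, distinct non-consecutive edges are disjoint, and no vertex lies in
three of the edges. The last condition follows from the others if `l ≥ 4`; for `l = 3` it says
that three edges through one common vertex are not a loose cycle. -/
structure IsLooseCycle (l : ℕ) (e : ZMod l → Set α) : Prop where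
  encard_inter_succ : ∀ i, (e i ∩ e (i + 1)).encard = 1
  disjoint : ∀ i j, i ≠ j → j ≠ i + 1 → i ≠ j + 1 → Disjoint (e i) (e j)
  inter_inter_eq_empty : ∀ i j k, i ≠ j → j ≠ k → i ≠ k → e i ∩ e j ∩ e k = ∅

/-- `H` contains a copy of the `r`-uniform loose cycle of length `l`. -/
def ContainsLooseCycle (H : Hypergraph α) (l r : ℕ) : Prop :=
  ∃ e : ZMod l → Set α, IsLooseCycle l e ∧ ∀ i, e i ∈ H.edgeSet ∧ (e i).encard = r

/-- `H` contains a copy of the `r`-uniform clique of order `n`. -/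
def ContainsClique (H : Hypergraph α) (n r : ℕ) : Prop :=
  ∃ s ⊆ H.vertexSet, s.encard = n ∧ ∀ e ⊆ s, e.encard = r → e ∈ H.edgeSet

/-- The set `s` of vertices of `H` is independent: it contains no edge of `H`. -/
def IsIndependent (H : Hypergraph α) (s : Set α) : Prop :=
  s ⊆ H.vertexSet ∧ ∀ e ∈ H.edgeSet, ¬ e ⊆ s

/-- The `r`-uniform clique on the vertices `0, …, N - 1`. -/
def uniformClique (N r : ℕ) : Hypergraph (Fin N) where
  vertexSet := Set.univ
  edgeSet := {e | e.encard = r}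
  subset_vertexSet_of_mem_edgeSet' := fun e _ => Set.subset_univ e

/-- For a colouring `c` of the edges of `K` with two colours, the hypergraph on the vertices of `K`
that consists of the edges of colour `b`. -/
def colourClass (K : Hypergraph α) (c : K.edgeSet → Bool) (b : Bool) : Hypergraph α where
  vertexSet := K.vertexSet
  edgeSet := {e | ∃ h : e ∈ K.edgeSet, c ⟨e, h⟩ = b}
  subset_vertexSet_of_mem_edgeSet' := fun _ he => K.subset_vertexSet_of_mem_edgeSet' he.1

/-- Every colouring of the edges of the `r`-uniform clique of order `N` with the colours red
(`true`) and blue (`false`) has a red `r`-uniform loose cycle of length `l` or a blue `r`-uniform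
clique of order `n`. -/
def RamseyProperty (l n r N : ℕ) : Prop :=
  ∀ c : (uniformClique N r).edgeSet → Bool,
    ((uniformClique N r).colourClass c true).ContainsLooseCycle l r ∨
      ((uniformClique N r).colourClass c false).ContainsClique n r

/-- `R` is the Ramsey number of the `r`-uniform loose cycle of length `l` versus the `r`-uniform
clique of order `n`: the least `N` with the Ramsey property. -/
def IsRamseyNumber (l n r R : ℕ) : Prop :=
  IsLeast {N : ℕ | RamseyProperty l n r N} R

end Hypergraph

/-!
Let `E` be a triple system on `n` vertices without a loose cycle of length `l`, and let `D` be
about `n ^ (1 / (m + 2))`, where `m = ⌊(l - 1) / 2⌋`. Either an independent set of order `n / D` is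
found directly, because the system is sparse or does not expand, or some subsystem on at least half
of the vertices has average degree at least of order `D ^ 2` and expands by the factor `D`.

In the latter case a search forest is grown from one vertex. Two vertices of the level of depth `i`
whose branches separate after depth `j` are joined by a loose path of length `2 * (i - j)`, which
can be rerouted around any small set. If most vertices of the level had edges to earlier branches,
there would be a loose path of length `l - 2 * (i - j)` through ever earlier branches, and together
with a link between its ends it would be a loose cycle of length `l`. Hence a positive proportion
of every level is independent and has few neighbours through pairs of its vertices, so that
expansion makes the next level larger by a factor of order `D`. The first level has order `D ^ 2`
vertices because every edge can be charged to one of its pairs in such a way that each pair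
receives at most `2 * l` edges. So the level of depth `m` has order `D ^ (m + 1)` vertices, and a
positive proportion of them is independent.
-/

namespace TripleSystem

open Finset

/-! ### Loose paths and loose cycles -/

section Paths

variable {α : Type*}

section LooseCycle

variable {l : ℕ} {s w : ZMod l → α}

theorem eq_of_mem_inter_of_injective (hs : s.Injective) (hw : w.Injective)
    (hsw : ∀ i j, s i ≠ w j) {i j : ZMod l} (hij : i ≠ j) {x : α}
    (hi : x ∈ ({s i, w i, s (i + 1)} : Set α)) (hj : x ∈ ({s j, w j, s (j + 1)} : Set α)) :
    x = s i ∧ i = j + 1 ∨ x = s j ∧ j = i + 1 := by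
  simp only [Set.mem_insert_iff, Set.mem_singleton_iff] at hi hj
  have hs' : ∀ a b, s a = s b → a = b := fun _ _ h => hs h
  have hw' : ∀ a b, w a = w b → a = b := fun _ _ h => hw h
  grind

theorem isLooseCycle_of_injective (hl : 3 ≤ l) (hs : s.Injective) (hw : w.Injective)
    (hsw : ∀ i j, s i ≠ w j) :
    Hypergraph.IsLooseCycle l fun i => ({s i, w i, s (i + 1)} : Set α) := by
  have key := @eq_of_mem_inter_of_injective _ _ _ _ hs hw hsw
  have one_ne : (1 : ZMod l) ≠ 0 := by
    have : Fact (1 < l) := ⟨by omega⟩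
    exact one_ne_zero
  have two_ne : (1 : ZMod l) + 1 ≠ 0 := by
    rw [one_add_one_eq_two, ← Nat.cast_ofNat, Ne, ZMod.natCast_eq_zero_iff]
    exact fun h => absurd (Nat.le_of_dvd two_pos h) (by omega)
  refine ⟨fun i => ?_, fun i j hij hj hi => ?_, fun i j k hij hjk hik => ?_⟩
  · rw [Set.encard_eq_one]
    refine ⟨s (i + 1), Set.Subset.antisymm (fun x hx => ?_) (by simp)⟩
    rcases key (by simpa using one_ne) hx.1 hx.2 with ⟨-, h⟩ | ⟨h, -⟩
    · rw [add_assoc, left_eq_add] at h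
      exact absurd h two_ne
    · exact h
  · exact Set.disjoint_left.2 fun x hx hx' =>
      (key hij hx hx').elim (fun h => hi h.2) fun h => hj h.2
  · refine Set.eq_empty_of_forall_notMem fun x hx => ?_
    have hs' : ∀ a b, s a = s b → a = b := fun _ _ h => hs h
    have hij' := key hij hx.1.1 hx.1.2
    have hjk' := key hjk hx.1.2 hx.2
    have hik' := key hik hx.1.1 hx.2
    grind

end LooseCycle

variable [DecidableEq α]

/-- `LoosePath E k a b V`: the triple system `E` has a loose path with `k` edges from `a` to `b`
whose vertex set is `V`. Consecutive edges share a single vertex and there are no other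
intersections. -/
inductive LoosePath (E : Finset (Finset α)) : ℕ → α → α → Finset α → Prop
  | nil (a : α) : LoosePath E 0 a a {a}
  | cons {k : ℕ} {a w c b : α} {V : Finset α} (edge : {a, w, c} ∈ E) (path : LoosePath E k c b V)
      (ne : a ≠ w) (left_notMem : a ∉ V) (middle_notMem : w ∉ V) :
      LoosePath E (k + 1) a b (insert a (insert w V))

/-- The triple system `E` has a loose cycle with `l` edges: a loose path with `l - 1` edges whose
ends are joined by an edge through a new vertex. -/
def HasLooseCycle (E : Finset (Finset α)) (l : ℕ) : Prop :=
  ∃ k a b w V, k + 1 = l ∧ LoosePath E k a b V ∧ w ∉ V ∧ {b, w, a} ∈ E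

theorem triple_rotate (a b c : α) : ({a, b, c} : Finset α) = {b, c, a} := by
  rw [insert_comm, pair_comm a c]

theorem triple_reverse (a b c : α) : ({a, b, c} : Finset α) = {c, b, a} := by
  rw [insert_comm, pair_comm a c, insert_comm]

variable {E F : Finset (Finset α)} {a b c w : α} {k k' : ℕ} {V V' : Finset α}

namespace LoosePath

theorem left_mem (h : LoosePath E k a b V) : a ∈ V := by
  cases h <;> simp

theorem right_mem (h : LoosePath E k a b V) : b ∈ V := by
  induction h with
  | nil a => simp
  | cons _ _ _ _ _ ih => simp [ih]

theorem card_le (h : LoosePath E k a b V) : #V ≤ 2 * k + 1 := by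
  induction h with
  | nil a => simp
  | @cons k a w _ _ V _ _ _ _ _ ih =>
    have := card_le_two (a := a) (b := w)
    have := card_union_le {a, w} V
    rw [insert_union, singleton_union] at this
    omega

theorem mono (h : LoosePath E k a b V) (hEF : E ⊆ F) : LoosePath F k a b V := by
  induction h with
  | nil a => exact .nil a
  | cons edge _ ne ha hw ih => exact .cons (hEF edge) ih ne ha hw

theorem append (hP : LoosePath E k a b V) (hQ : LoosePath E k' b c V')
    (h : ∀ x ∈ V, x ∈ V' → x = b) : LoosePath E (k + k') a c (V ∪ V') := by
  induction hP with
  | nil a => simpa [insert_eq_of_mem hQ.left_mem] using hQ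
  | @cons k a w d b V edge path ne ha hw ih =>
    have hb := path.right_mem
    rw [Nat.add_right_comm, insert_union, insert_union]
    exact .cons edge (ih hQ (by grind)) ne (by grind) (by grind)

theorem single (h : {a, w, b} ∈ E) (haw : a ≠ w) (hab : a ≠ b) (hwb : w ≠ b) :
    LoosePath E 1 a b {a, w, b} :=
  .cons h (.nil b) haw (by simpa using hab) (by simpa using hwb)

theorem hasLooseCycle (hP : LoosePath E k a b V) (hQ : LoosePath E k' b a V') (hab : a ≠ b)
    (h : ∀ x ∈ V, x ∈ V' → x = a ∨ x = b) : HasLooseCycle E (k + k') := by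
  cases hQ with
  | nil => exact absurd rfl hab
  | @cons k' _ w c _ V' edge path ne hb hw =>
    have ha := path.right_mem
    exact ⟨k' + k, c, b, w, V' ∪ V, by omega, path.append hP (by grind), by grind, edge⟩

theorem exists_enumeration (h : LoosePath E k a b V) :
    ∃ s t : ℕ → α, s 0 = a ∧ s k = b ∧ (∀ i < k, {s i, t i, s (i + 1)} ∈ E) ∧
      (∀ i ≤ k, ∀ j ≤ k, s i = s j → i = j) ∧ (∀ i < k, ∀ j < k, t i = t j → i = j) ∧
      (∀ i ≤ k, ∀ j < k, s i ≠ t j) ∧ (∀ i ≤ k, s i ∈ V) ∧ ∀ i < k, t i ∈ V := by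
  induction h with
  | nil a => exact ⟨fun _ => a, fun _ => a, by simp⟩
  | @cons k a w c b V edge _ ne ha hw ih =>
    obtain ⟨s, t, hs0, hsk, hedge, hs, ht, hst, hsV, htV⟩ := ih
    let s' : ℕ → α := fun | 0 => a | i + 1 => s i
    let t' : ℕ → α := fun | 0 => w | i + 1 => t i
    refine ⟨s', t', rfl, hsk, ?_, ?_, ?_, ?_, ?_, ?_⟩
    · rintro (_ | i) hi
      · simpa [s', t', hs0] using edge
      · exact hedge i (by omega)
    · rintro (_ | i) hi (_ | j) hj hij <;> grind
    · rintro (_ | i) hi (_ | j) hj hij <;> grind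
    · rintro (_ | i) hi (_ | j) hj <;> grind
    · rintro (_ | i) hi <;> grind
    · rintro (_ | i) hi <;> grind

end LoosePath

theorem HasLooseCycle.mono {l : ℕ} (h : HasLooseCycle E l) (hEF : E ⊆ F) : HasLooseCycle F l := by
  obtain ⟨k, a, b, w, V, hk, hP, hw, hE⟩ := h
  exact ⟨k, a, b, w, V, hk, hP.mono hEF, hw, hEF hE⟩

theorem HasLooseCycle.exists_isLooseCycle {l : ℕ} (hl : 3 ≤ l) (h : HasLooseCycle E l) :
    ∃ e : ZMod l → Set α, Hypergraph.IsLooseCycle l e ∧ ∀ i, ∃ t ∈ E, e i = (t : Set α) := by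
  obtain ⟨k, a, b, w, V, rfl, hP, hw, hclose⟩ := h
  obtain ⟨s, t, rfl, rfl, hedge, hs, ht, hst, hsV, htV⟩ := hP.exists_enumeration
  let t' : ℕ → α := fun i => if i < k then t i else w
  have ht' : ∀ i ≤ k, ∀ j ≤ k, t' i = t' j → i = j := by grind
  have hst' : ∀ i ≤ k, ∀ j ≤ k, s i ≠ t' j := by grind
  have hval : ∀ i : ZMod (k + 1), i.val ≤ k := fun i => Nat.le_of_lt_succ i.val_lt
  refine ⟨_, isLooseCycle_of_injective hl (s := fun i => s i.val) (w := fun i => t' i.val)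
    (fun i j hij => ZMod.val_injective _ (hs _ (hval i) _ (hval j) hij))
    (fun i j hij => ZMod.val_injective _ (ht' _ (hval i) _ (hval j) hij))
    (fun i j => hst' _ (hval i) _ (hval j)),
    fun i => ⟨{s i.val, t' i.val, s (i + 1).val}, ?_, by simp⟩⟩
  have : Fact (1 < k + 1) := ⟨by omega⟩
  rw [ZMod.val_add, ZMod.val_one]
  rcases (hval i).lt_or_eq with hi | hi
  · rw [Nat.mod_eq_of_lt (by omega)]
    simpa [t', hi] using hedge _ hi
  · simpa [t', hi] using hclose

end Paths

/-! ### Codegrees -/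

section Codegree

variable {α : Type*} [DecidableEq α] {E : Finset (Finset α)} {a b c : α} {S : Finset α}

theorem ne_of_mem (hE : (E : Set (Finset α)).Sized 3) (h : {a, b, c} ∈ E) :
    a ≠ b ∧ a ≠ c ∧ b ≠ c := by
  have h3 := hE h
  refine ⟨?_, ?_, ?_⟩ <;> rintro rfl
  · rw [insert_eq_of_mem (mem_insert_self _ _)] at h3
    exact absurd h3 (card_le_two.trans_lt (by omega)).ne
  · rw [insert_eq_of_mem (by simp)] at h3
    exact absurd h3 (card_le_two.trans_lt (by omega)).ne
  · rw [pair_eq_singleton] at h3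
    exact absurd h3 (card_le_two.trans_lt (by omega)).ne

theorem eq_triple_of_pair_subset {e : Finset α} (he : #e = 3) (hab : a ≠ b) (h : {a, b} ⊆ e) :
    ∃ c, e = {a, b, c} := by
  obtain ⟨c, hc⟩ : ∃ c, e \ {a, b} = {c} := by
    rw [← card_eq_one, card_sdiff_of_subset h, he, card_pair hab]
  exact ⟨c, by rw [← union_sdiff_of_subset h, hc, insert_union, singleton_union]⟩

theorem exists_eq_triple_of_mem {e : Finset α} (he : #e = 3) (ha : a ∈ e) :
    ∃ b c, e = {a, b, c} := by
  obtain ⟨b, c, -, hbc⟩ := card_eq_two.1 (card_erase_of_mem ha ▸ by rw [he] : #(e.erase a) = 2)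
  exact ⟨b, c, by rw [← hbc, insert_erase ha]⟩

/-- The number of triples of `E` that contain `q`; used for pairs `q`. -/
def codegree (E : Finset (Finset α)) (q : Finset α) : ℕ := #{e ∈ E | q ⊆ e}

theorem exists_third_of_card_lt_codegree (hE : (E : Set (Finset α)).Sized 3) (hab : a ≠ b)
    (hS : #S < codegree E {a, b}) : ∃ w ∉ S, {a, b, w} ∈ E := by
  by_contra! hcon
  refine hS.not_ge ((card_le_card fun e he => ?_).trans (card_image_le (f := fun w => {a, b, w})))
  rw [mem_filter] at he
  obtain ⟨w, rfl⟩ := eq_triple_of_pair_subset (hE he.1) hab he.2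
  exact mem_image_of_mem _ (by_contra fun hw => hcon w hw he.1)

theorem exists_loosePath_of_lt_codegree (hE : (E : Set (Finset α)).Sized 3) {N : ℕ}
    (hN : ∀ a b c, {a, b, c} ∈ E → N < codegree E {a, b}) {k : ℕ} (h : {a, b, c} ∈ E)
    (ha : a ∉ S) (hb : b ∉ S) (hS : #S + 2 * k ≤ N) :
    ∃ V, LoosePath E (k + 1) a b V ∧ Disjoint V S := by
  have hab := (ne_of_mem hE h).1
  induction k generalizing a b c S with
  | zero =>
    obtain ⟨w, hw, habw⟩ := exists_third_of_card_lt_codegree hE hab (S := S)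
      (by have := hN a b c h; omega)
    obtain ⟨-, haw, hbw⟩ := ne_of_mem hE habw
    rw [pair_comm] at habw
    exact ⟨_, .single habw haw hab hbw.symm, by simp [ha, hb, hw]⟩
  | succ k ih =>
    obtain ⟨t, ht, habt⟩ := exists_third_of_card_lt_codegree hE hab (S := S)
      (by have := hN a b c h; omega)
    obtain ⟨-, hat, hbt⟩ := ne_of_mem hE habt
    obtain ⟨w, hw, hatw⟩ := exists_third_of_card_lt_codegree hE hat (S := insert b S) (by
      have := hN a t b (by rwa [pair_comm])
      have := card_insert_le b S
      omega)
    obtain ⟨-, haw, htw⟩ := ne_of_mem hE hatw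
    rw [mem_insert, not_or] at hw
    obtain ⟨V, hP, hV⟩ := ih (a := t) (b := b) (c := a) (S := insert a (insert w S))
      (by rwa [triple_reverse])
      (by grind) (by grind) (by
        have := card_insert_le a (insert w S)
        have := card_insert_le w S
        omega) hbt.symm
    exact ⟨_, .cons (by rwa [pair_comm]) hP haw (by grind) (by grind), by grind⟩

theorem exists_codegree_le {l : ℕ} (hE : (E : Set (Finset α)).Sized 3) (hl : 3 ≤ l)
    (hcycle : ¬HasLooseCycle E l) (hne : E.Nonempty) :
    ∃ a b c, {a, b, c} ∈ E ∧ codegree E {a, b} ≤ 2 * l := by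
  by_contra! hcon
  obtain ⟨e, he⟩ := hne
  obtain ⟨a, b, c, -, -, -, rfl⟩ := card_eq_three.1 (hE he)
  obtain ⟨-, hac, hbc⟩ := ne_of_mem hE he
  obtain ⟨V, hP, hV⟩ := exists_loosePath_of_lt_codegree hE hcon (k := l - 2) (S := {c}) he
    (by simpa using hac) (by simpa using hbc) (by simp; omega)
  exact hcycle ⟨l - 2 + 1, a, b, c, V, by omega, hP, by simpa using hV, by rwa [← triple_rotate]⟩

/-- Repeatedly remove all the triples through a pair of small codegree and charge them to it. -/
theorem exists_charging {l : ℕ} (hE : (E : Set (Finset α)).Sized 3) (hl : 3 ≤ l)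
    (hcycle : ¬HasLooseCycle E l) :
    ∃ p : Finset α → Finset α, (∀ e ∈ E, p e ⊆ e ∧ #(p e) = 2) ∧
      ∀ q, #{e ∈ E | p e = q} ≤ 2 * l := by
  induction E using Finset.strongInduction with
  | H E ih =>
  rcases E.eq_empty_or_nonempty with rfl | hne
  · exact ⟨id, by simp, by simp⟩
  obtain ⟨a, b, c, habc, hdeg⟩ := exists_codegree_le hE hl hcycle hne
  have hab := (ne_of_mem hE habc).1
  let F := {e ∈ E | ¬{a, b} ⊆ e}
  have hFE : F ⊂ E := filter_ssubset.2 ⟨_, habc, not_not.2 (by grind)⟩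
  obtain ⟨p, hp, hpq⟩ := ih F hFE (fun e he => hE (hFE.subset he))
    fun h => hcycle (h.mono hFE.subset)
  have hpF : ∀ e ∈ E, ¬{a, b} ⊆ e → p e ⊆ e ∧ #(p e) = 2 :=
    fun e he h => hp e (mem_filter.2 ⟨he, h⟩)
  refine ⟨fun e => if {a, b} ⊆ e then {a, b} else p e, fun e he => ?_, fun q => ?_⟩
  · have := card_pair hab
    grind
  · rcases eq_or_ne q {a, b} with rfl | hq
    · refine (card_le_card fun e he => ?_).trans hdeg
      grind
    · refine (card_le_card fun e he => ?_).trans (hpq q)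
      grind

end Codegree

/-! ### Independent sets in sparse triple systems -/

section Coloring

variable {α : Type*} {E : Finset (Finset α)} {U : Finset α} {t : ℕ}

/-- `S` is independent in the set system `E`: it contains no member of `E`. -/
def Indep (E : Finset (Finset α)) (S : Finset α) : Prop :=
  ∀ e ∈ E, ¬e ⊆ S

theorem card_filter_eq_eq_mul_sq_le {ι : Type*} [Fintype ι] [DecidableEq ι] {x y z : ι}
    (hxy : x ≠ y) (hxz : x ≠ z) (hyz : y ≠ z) :
    #{f : ι → Fin t | f y = f x ∧ f z = f x} * t ^ 2 ≤ Fintype.card (ι → Fin t) := by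
  let recolor : (ι → Fin t) × Fin t × Fin t → ι → Fin t :=
    fun q => Function.update (Function.update q.1 y q.2.1) z q.2.2
  have hinj : Set.InjOn recolor
      (({f : ι → Fin t | f y = f x ∧ f z = f x} : Finset _) ×ˢ (univ : Finset (Fin t × Fin t)) :
        Finset _) := by
    rintro ⟨f, c, d⟩ hf ⟨f', c', d'⟩ hf' heq
    simp only [coe_product, coe_filter, coe_univ, Set.mem_prod, Set.mem_ofPred_eq, mem_univ,
      true_and, Set.mem_univ, and_true] at hf hf'
    have hval : ∀ u, recolor (f, c, d) u = recolor (f', c', d') u := congrFun heq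
    simp only [recolor, Function.update_apply] at hval
    have hd : d = d' := by simpa using hval z
    have hc : c = c' := by simpa [hyz] using hval y
    have hx : f x = f' x := by simpa [hxy, hxz] using hval x
    have hff : f = f' := funext fun u => by have := hval u; grind
    rw [hff, hc, hd]
  have := card_le_card_of_injOn recolor (t := univ) (by simp) hinj
  rwa [card_product, card_univ, card_univ, Fintype.card_prod, Fintype.card_fin, ← sq] at this

/-- A uniformly random colouring of the vertices with `t` colours makes each triple
monochromatic with probability `t⁻²`. -/
theorem exists_coloring_card_monochromatic_mul_sq_le (hE : (E : Set (Finset α)).Sized 3)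
    (ht : 0 < t) : ∃ f : α → Fin t, #{e ∈ E | ∃ c, ∀ u ∈ e, f u = c} * t ^ 2 ≤ #E := by
  classical
  let W := E.biUnion id
  let extend : (W → Fin t) → α → Fin t := fun g u => if h : u ∈ W then g ⟨u, h⟩ else ⟨0, ht⟩
  have hmono : ∀ e ∈ E,
      #{g | ∃ c, ∀ u ∈ e, extend g u = c} * t ^ 2 ≤ Fintype.card (W → Fin t) := by
    intro e he
    have heW : e ⊆ W := subset_biUnion_of_mem id he
    obtain ⟨x, y, z, hxy, hxz, hyz, rfl⟩ := card_eq_three.1 (hE he)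
    have hx : x ∈ W := heW (by simp)
    have hy : y ∈ W := heW (by simp)
    have hz : z ∈ W := heW (by simp)
    refine (Nat.mul_le_mul_right _ (card_le_card fun g hg => ?_)).trans
      (card_filter_eq_eq_mul_sq_le (x := (⟨x, hx⟩ : W)) (y := ⟨y, hy⟩) (z := ⟨z, hz⟩)
        (by simpa using hxy) (by simpa using hxz) (by simpa using hyz))
    simp only [mem_filter, mem_univ, true_and, mem_insert, mem_singleton, forall_eq_or_imp,
      forall_eq, extend, hx, hy, hz, dif_pos] at hg ⊢
    obtain ⟨c, hcx, hcy, hcz⟩ := hg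
    simp [hcx, hcy, hcz]
  have : Nonempty (Fin t) := ⟨⟨0, ht⟩⟩
  obtain ⟨g, -, hg⟩ := exists_le_of_sum_le (s := (univ : Finset (W → Fin t)))
    (f := fun g => #{e ∈ E | ∃ c, ∀ u ∈ e, extend g u = c} * t ^ 2) (g := fun _ => #E)
    univ_nonempty <| calc
      _ = ∑ e ∈ E, #{g | ∃ c, ∀ u ∈ e, extend g u = c} * t ^ 2 := by
        simp_rw [← sum_mul, card_filter]
        rw [sum_comm]
      _ ≤ ∑ _e ∈ E, Fintype.card (W → Fin t) := sum_le_sum hmono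
      _ = _ := by simp [mul_comm]
  exact ⟨extend g, hg⟩

theorem exists_subset_card_add_mul_card_le [DecidableEq α] (hE : (E : Set (Finset α)).Sized 3)
    (ht : 0 < t) (h : 2 * #E ≤ t ^ 2 * #U) :
    ∃ S ⊆ U, #U + 2 * t * #{e ∈ E | e ⊆ S} ≤ 2 * t * #S := by
  obtain ⟨f, hf⟩ := exists_coloring_card_monochromatic_mul_sq_le hE ht
  let color : Fin t → Finset α := fun c => {u ∈ U | f u = c}
  have hU : ∑ c, #(color c) = #U := (card_eq_sum_card_fiberwise (by simp)).symm
  have hmono : ∑ c, #{e ∈ E | e ⊆ color c} ≤ #{e ∈ E | ∃ c, ∀ u ∈ e, f u = c} := by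
    rw [← card_biUnion]
    · refine card_le_card fun e he => ?_
      simp only [mem_biUnion, mem_filter, mem_univ, true_and] at he ⊢
      obtain ⟨c, he, hc⟩ := he
      exact ⟨he, c, fun u hu => (mem_filter.1 (hc hu)).2⟩
    · refine fun c _ c' _ hcc' => disjoint_left.2 fun e he he' => hcc' ?_
      rw [mem_filter] at he he'
      obtain ⟨u, hu⟩ : e.Nonempty := card_pos.1 (by rw [hE he.1]; norm_num)
      exact (mem_filter.1 (he.2 hu)).2.symm.trans (mem_filter.1 (he'.2 hu)).2
  have hsum : ∑ c, (#U + 2 * t * #{e ∈ E | e ⊆ color c}) ≤ ∑ c, 2 * t * #(color c) := by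
    have : 2 * #{e ∈ E | ∃ c, ∀ u ∈ e, f u = c} ≤ #U := by
      refine le_of_mul_le_mul_left (a := t ^ 2) ?_ (by positivity)
      linarith
    rw [sum_add_distrib, ← mul_sum, ← mul_sum, hU, sum_const, card_univ, Fintype.card_fin,
      smul_eq_mul]
    nlinarith [Nat.mul_le_mul_left t (Nat.mul_le_mul_left 2 hmono)]
  have : Nonempty (Fin t) := ⟨⟨0, ht⟩⟩
  obtain ⟨c, -, hc⟩ := exists_le_of_sum_le univ_nonempty hsum
  exact ⟨color c, filter_subset _ _, hc⟩

theorem exists_indep_card_le_add [DecidableEq α] (hne : ∀ e ∈ E, e.Nonempty) (S : Finset α) :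
    ∃ S' ⊆ S, Indep E S' ∧ #S ≤ #S' + #{e ∈ E | e ⊆ S} := by
  rcases E.eq_empty_or_nonempty with rfl | ⟨e₀, he₀⟩
  · exact ⟨S, subset_rfl, by simp [Indep], by simp⟩
  have : Nonempty α := (hne e₀ he₀).to_type
  choose! v hv using hne
  refine ⟨S \ {e ∈ E | e ⊆ S}.image v, sdiff_subset, fun e he heS => ?_, ?_⟩
  · exact (mem_sdiff.1 (heS (hv e he))).2
      (mem_image_of_mem v (mem_filter.2 ⟨he, heS.trans sdiff_subset⟩))
  · have := le_card_sdiff ({e ∈ E | e ⊆ S}.image v) S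
    have := card_image_le (s := {e ∈ E | e ⊆ S}) (f := v)
    omega

theorem exists_indep_of_two_mul_card_le (hE : (E : Set (Finset α)).Sized 3) (ht : 0 < t)
    (h : 2 * #E ≤ t ^ 2 * #U) : ∃ S ⊆ U, Indep E S ∧ #U ≤ 2 * t * #S := by
  classical
  obtain ⟨S, hSU, hS⟩ := exists_subset_card_add_mul_card_le hE ht h
  obtain ⟨S', hS'S, hS', hcard⟩ := exists_indep_card_le_add
    (fun e he => card_pos.1 (by rw [hE he]; norm_num)) S
  refine ⟨S', hS'S.trans hSU, hS', ?_⟩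
  nlinarith [Nat.mul_le_mul_left (2 * t) hcard]

end Coloring

/-! ### Levels of a search forest -/

section Levels

variable {α : Type*} [DecidableEq α] {E : Finset (Finset α)}

/-- `L` is the level of depth `i` of a search forest that uses only the vertices of `R ⊆ U`, and
`anc j x` is the ancestor of `x ∈ L` at depth `j`; depth `0` consists of a virtual root, whose
name `anc 0 x` carries no information. Two vertices of `L` that separate after depth `j` are
joined by a loose path of length `2 * (i - j)`. This path can be chosen to avoid any small set `S`
that contains no vertex of the earlier levels. -/
structure Level (E : Finset (Finset α)) (U : Finset α) (M i : ℕ) (R L : Finset α)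
    (anc : ℕ → α → α) : Prop where
  subset : L ⊆ R
  subset_univ : R ⊆ U
  anc_zero : ∀ x ∈ L, ∀ x' ∈ L, anc 0 x = anc 0 x'
  anc_self : ∀ x ∈ L, anc i x = x
  link : ∀ j < i, ∀ x ∈ L, ∀ x' ∈ L, anc j x = anc j x' → anc (j + 1) x ≠ anc (j + 1) x' →
    ∀ S : Finset α, #S + 4 * i ≤ M → x ∉ S → x' ∉ S → S ∩ R ⊆ L →
      ∃ V, LoosePath E (2 * (i - j)) x x' V ∧ Disjoint V S

/-- A matching of triples `{y, w y, π y}`, one for each `y ∈ L`, that hang from vertices `π y` of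
`X` and are otherwise disjoint and contained in `A`. -/
structure PendantFamily (E : Finset (Finset α)) (A X L : Finset α) (π w : α → α) : Prop where
  mem : ∀ y ∈ L, y ∈ A
  mate_mem : ∀ y ∈ L, w y ∈ A
  parent_mem : ∀ y ∈ L, π y ∈ X
  edge : ∀ y ∈ L, {y, w y, π y} ∈ E
  ne_mate : ∀ y ∈ L, ∀ y' ∈ L, y ≠ w y'
  mate_injOn : Set.InjOn w L

variable {U R L L' A X : Finset α} {M i j : ℕ} {anc : ℕ → α → α} {π w : α → α}

theorem LoosePath.extend {k : ℕ} {x x' y y' v v' : α} {V : Finset α} (h : LoosePath E k x x' V)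
    (hE : (E : Set (Finset α)).Sized 3) (hy : {y, v, x} ∈ E) (hy' : {y', v', x'} ∈ E)
    (hV : Disjoint V {y, v, y', v'}) (hyy' : y ≠ y') (hyv' : y ≠ v') (hvy' : v ≠ y')
    (hvv' : v ≠ v') : ∃ V', LoosePath E (k + 2) y y' V' ∧ V' ⊆ V ∪ {y, v, y', v'} := by
  obtain ⟨hyv, -, -⟩ := ne_of_mem hE hy
  obtain ⟨hyv₁, hyx', hvx'⟩ := ne_of_mem hE hy'
  rw [triple_reverse] at hy'
  have hx' := h.right_mem
  simp only [disjoint_insert_right, disjoint_singleton_right] at hV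
  refine ⟨_, .cons hy (h.append (.single hy' hvx'.symm hyx'.symm hyv₁.symm) ?_) hyv ?_ ?_, ?_⟩ <;>
    grind

theorem Level.zero {r : α} (hr : r ∈ U) : Level E U M 0 {r} {r} fun _ x => x where
  subset := subset_rfl
  subset_univ := singleton_subset_iff.2 hr
  anc_zero := by simp
  anc_self := by simp
  link := by simp

theorem Level.exists_loosePath (hL : Level E U M i R L anc) (hj : j ≤ i) {x x' : α} (hx : x ∈ L)
    (hx' : x' ∈ L) (heq : anc j x = anc j x') (hne : j < i → anc (j + 1) x ≠ anc (j + 1) x')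
    {S : Finset α} (hS : #S + 4 * i ≤ M) (hxS : x ∉ S) (hx'S : x' ∉ S) (hSR : S ∩ R ⊆ L) :
    ∃ V, LoosePath E (2 * (i - j)) x x' V ∧ Disjoint V S := by
  rcases hj.lt_or_eq with hji | rfl
  · exact hL.link j hji x hx x' hx' heq (hne hji) S hS hxS hx'S hSR
  · rw [hL.anc_self x hx, hL.anc_self x' hx'] at heq
    subst heq
    exact ⟨{x}, by simpa using .nil x, by simpa using hxS⟩

theorem Level.exists_loosePath_of_pendantFamily (hE : (E : Set (Finset α)).Sized 3)
    (hL : Level E U M i R L anc) (hP : PendantFamily E (U \ R) L L' π w) (hj : j ≤ i) {y y' : α}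
    (hy : y ∈ L') (hy' : y' ∈ L') (hyy' : y ≠ y') (heq : anc j (π y) = anc j (π y'))
    (hne : j < i → anc (j + 1) (π y) ≠ anc (j + 1) (π y')) {S : Finset α}
    (hS : #S + 4 * (i + 1) ≤ M) (hyS : y ∉ S) (hy'S : y' ∉ S)
    (hSR : S ∩ (R ∪ L' ∪ L'.image w) ⊆ L') :
    ∃ V, LoosePath E (2 * (i - j) + 2) y y' V ∧ Disjoint V S := by
  have hSL : ∀ z ∈ S, z ∈ R ∪ L' ∪ L'.image w → z ∈ L' := fun z hz hzR => by grind
  have hA := hP.mem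
  have hwA := hP.mate_mem
  have hπR : ∀ z ∈ L', π z ∈ R := fun z hz => hL.subset (hP.parent_mem z hz)
  have hww' : w y ≠ w y' := fun h => hyy' (hP.mate_injOn hy hy' h)
  have hwS : ∀ z ∈ L', w z ∉ S := fun z hz hzS =>
    hP.ne_mate _ (hSL _ hzS (by grind)) z hz rfl
  obtain ⟨V, hV, hVS⟩ := hL.exists_loosePath hj (hP.parent_mem y hy) (hP.parent_mem y' hy')
    heq hne (S := S ∪ {y, w y, y', w y'})
    (by
      have := card_union_le S {y, w y, y', w y'}
      have := card_le_four (a := y) (b := w y) (c := y') (d := w y')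
      omega)
    (by grind) (by grind) (by grind)
  obtain ⟨V', hV', hsub⟩ := hV.extend hE (hP.edge y hy) (hP.edge y' hy')
    (hVS.mono_right subset_union_right) hyy' (hP.ne_mate y hy y' hy')
    (hP.ne_mate y' hy' y hy).symm hww'
  refine ⟨V', hV', ?_⟩
  have := hwS y hy
  have := hwS y' hy'
  grind

theorem Level.succ (hE : (E : Set (Finset α)).Sized 3) (hL : Level E U M i R L anc)
    (hP : PendantFamily E (U \ R) L L' π w) :
    Level E U M (i + 1) (R ∪ L' ∪ L'.image w) L'
      (fun k y => if k ≤ i then anc k (π y) else y) where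
  subset := subset_union_right.trans subset_union_left
  subset_univ := by
    have := hL.subset_univ
    have := hP.mem
    have := hP.mate_mem
    grind
  anc_zero y hy y' hy' := by
    simpa using hL.anc_zero _ (hP.parent_mem y hy) _ (hP.parent_mem y' hy')
  anc_self := by simp
  link := by
    intro j hj y hy y' hy' heq hne S hS hyS hy'S hSR
    have hji : j ≤ i := by omega
    rw [show 2 * (i + 1 - j) = 2 * (i - j) + 2 by omega]
    exact hL.exists_loosePath_of_pendantFamily hE hP hji hy hy' (by rintro rfl; exact hne rfl)
      (by simpa [hji] using heq) (fun h => by simpa [hji, Nat.succ_le_of_lt h] using hne) hS hyS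
      hy'S hSR

theorem PendantFamily.insert (h : PendantFamily E A X L π w) {b c z : α} (hb : b ∈ A) (hc : c ∈ A)
    (hz : z ∈ X) (hE : {b, c, z} ∈ E) (hbc : b ≠ c) (hbL : b ∉ L ∪ L.image w)
    (hcL : c ∉ L ∪ L.image w) :
    PendantFamily E A X (insert b L) (Function.update π b z) (Function.update w b c) := by
  obtain ⟨mem, mate_mem, parent_mem, edge, ne_mate, mate_injOn⟩ := h
  simp only [mem_union, mem_image, not_or, not_exists, not_and] at hbL hcL
  have hinj : ∀ y ∈ L, ∀ y' ∈ L, w y = w y' → y = y' := fun y hy y' hy' => mate_injOn hy hy'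
  constructor
  case edge =>
    rintro y hy
    rcases mem_insert.1 hy with rfl | hy
    · simpa using hE
    · grind [Function.update_apply]
  case mate_injOn =>
    intro y hy y' hy' heq
    rw [mem_coe] at hy hy'
    grind [Function.update_apply]
  all_goals grind [Function.update_apply]

theorem exists_maximal_pendantFamily (E : Finset (Finset α)) (A X : Finset α) :
    ∃ L π w, PendantFamily E A X L π w ∧ ∀ b ∈ A, ∀ c ∈ A, ∀ z ∈ X, b ≠ c → {b, c, z} ∈ E →
      b ∈ L ∪ L.image w ∨ c ∈ L ∪ L.image w := by
  classical
  obtain ⟨L, hL, hmax⟩ := exists_max_image {L ∈ A.powerset | ∃ π w, PendantFamily E A X L π w} card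
    ⟨∅, by simpa using ⟨id, id, by constructor <;> simp⟩⟩
  obtain ⟨π, w, h⟩ := (mem_filter.1 hL).2
  refine ⟨L, π, w, h, fun b hb c hc z hz hbc hE => ?_⟩
  by_contra! hcon
  have h' := h.insert hb hc hz hE hbc hcon.1 hcon.2
  have := hmax _ (mem_filter.2 ⟨mem_powerset.2 h'.mem, _, _, h'⟩)
  rw [card_insert_of_notMem fun hbL => hcon.1 (mem_union_left _ hbL)] at this
  omega

end Levels

/-! ### Sparse subsets of a level -/

section Sparse

variable {α β γ : Type*} [DecidableEq α] {E : Finset (Finset α)}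

open Classical in
/-- The vertices of `T` that form a triple with two `r`-related vertices of `X`. -/
noncomputable def tips (E : Finset (Finset α)) (T : Finset α) (r : α → α → Prop) (X : Finset α) :
    Finset α :=
  {y ∈ T | ∃ a ∈ X, ∃ b ∈ X, r a b ∧ {a, b, y} ∈ E}

variable {T W I J U R L : Finset α} {r : α → α → Prop} {f : α → γ} {g : α → β} {M : ℕ}

theorem mem_tips {y : α} :
    y ∈ tips E T r I ↔ y ∈ T ∧ ∃ a ∈ I, ∃ b ∈ I, r a b ∧ {a, b, y} ∈ E := by
  simp [tips]

/-- Each class of `I` splits into branches, the classes and the branches being the fibres of `g`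
and of `f`. Every triple inside a class lies in a single branch, and the pairs of vertices from
different branches of a class form triples with at most `M * #I` vertices of `T`. -/
structure Sparse (E : Finset (Finset α)) (T : Finset α) (M : ℕ) (f : α → γ) (g : α → β)
    (I : Finset α) : Prop where
  eq_of_mem : ∀ a ∈ I, ∀ b ∈ I, ∀ c ∈ I, {a, b, c} ∈ E → g a = g b → g a = g c → f a = f b
  card_tips_le : #(tips E T (fun a b => g a = g b ∧ f a ≠ f b) I) ≤ M * #I

theorem Sparse.card_tips_le_add (h : Sparse E T M f g I) (hIW : I ⊆ W) :
    #(tips E T (fun a b => g a = g b) I) ≤ #(tips E T (fun a b => f a = f b) W) + M * #I := by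
  have hsub : tips E T (fun a b => g a = g b) I ⊆
      tips E T (fun a b => f a = f b) W ∪ tips E T (fun a b => g a = g b ∧ f a ≠ f b) I := by
    intro y hy
    simp only [mem_union, mem_tips] at hy ⊢
    grind
  exact (card_le_card hsub).trans ((card_union_le _ _).trans
    (Nat.add_le_add_left h.card_tips_le _))

section Order

variable [LinearOrder γ]

/-- From `v` an edge leads to a vertex `a ∈ I` in an earlier branch of the class of `v`. The middle
vertex `y` of this edge lies in `I` or can be chosen in `T` outside any prescribed set of at most
`M` vertices. -/
def Linked (E : Finset (Finset α)) (T : Finset α) (M : ℕ) (f : α → γ) (g : α → β) (v : α)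
    (I : Finset α) : Prop :=
  ∀ S, #S ≤ M → ∃ a ∈ I, ∃ y ∈ I ∪ T \ S, {v, a, y} ∈ E ∧ g a = g v ∧ f a < f v

theorem Linked.mono {v : α} (h : Linked E T M f g v I) (hIJ : I ⊆ J) : Linked E T M f g v J := by
  intro S hS
  obtain ⟨a, ha, y, hy, h⟩ := h S hS
  exact ⟨a, hIJ ha, y, union_subset_union_left hIJ hy, h⟩

theorem Sparse.insert_of_not_linked {v : α} (h : Sparse E T M f g I)
    (hE : (E : Set (Finset α)).Sized 3) (hmax : ∀ a ∈ I, f a ≤ f v) (hv : v ∉ I)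
    (hlink : ¬Linked E T M f g v I) :
    Sparse E T M f g (insert v I) := by
  simp only [Linked, not_forall, not_exists, not_and] at hlink
  obtain ⟨S, hS, hlink⟩ := hlink
  replace hlink : ∀ a ∈ I, ∀ y ∈ I ∪ T \ S, {v, a, y} ∈ E → g a = g v → f a = f v :=
    fun a ha y hy he hg => ((hmax a ha).lt_or_eq).resolve_left (hlink a ha y hy he hg)
  constructor
  · intro a ha b hb c hc he hgb hgc
    obtain ⟨hab, hac, hbc⟩ := ne_of_mem hE he
    have he' : {b, a, c} ∈ E := by rwa [insert_comm]
    have he'' : {c, a, b} ∈ E := by rwa [triple_rotate]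
    have hI : ∀ z ∈ insert v I, z ≠ v → z ∈ I := fun z hz hzv => mem_of_mem_insert_of_ne hz hzv
    by_cases hav : a = v
    · subst hav
      exact (hlink b (hI b hb hab.symm) c (mem_union_left _ (hI c hc hac.symm)) he hgb.symm).symm
    by_cases hbv : b = v
    · subst hbv
      exact hlink a (hI a ha hab) c (mem_union_left _ (hI c hc hbc.symm)) he' hgb
    by_cases hcv : c = v
    · subst hcv
      have he₃ : {c, b, a} ∈ E := by rwa [triple_reverse]
      rw [hlink a (hI a ha hac) b (mem_union_left _ (hI b hb hbc)) he'' hgc,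
        hlink b (hI b hb hbc) a (mem_union_left _ (hI a ha hac)) he₃ (hgb.symm.trans hgc)]
    exact h.eq_of_mem a (hI a ha hav) b (hI b hb hbv) c (hI c hc hcv) he hgb hgc
  · have hsub : tips E T (fun a b => g a = g b ∧ f a ≠ f b) (insert v I) ⊆
        tips E T (fun a b => g a = g b ∧ f a ≠ f b) I ∪ S := by
      intro y hy
      obtain ⟨hyT, a, ha, b, hb, ⟨hg, hf⟩, he⟩ := mem_tips.1 hy
      rw [mem_union, mem_tips]
      have := insert_comm a b {y}
      grind
    calc _ ≤ M * #I + M :=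
          (card_le_card hsub).trans ((card_union_le _ _).trans (add_le_add h.card_tips_le hS))
      _ = M * #(insert v I) := by rw [card_insert_of_notMem hv, mul_add, mul_one]

theorem exists_sparse (hE : (E : Set (Finset α)).Sized 3) (T : Finset α) (M : ℕ) (f : α → γ)
    (g : α → β) (W : Finset α) :
    ∃ I ⊆ W, Sparse E T M f g I ∧ ∀ v ∈ W, v ∉ I → Linked E T M f g v I := by
  induction W using induction_on_max_value f with
  | empty => exact ⟨∅, subset_rfl, ⟨by simp, by simp [tips]⟩, by simp⟩
  | insert v W hv hmax ih =>
    obtain ⟨I, hIW, hI, hlink⟩ := ih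
    by_cases hvI : Linked E T M f g v I
    · exact ⟨I, hIW.trans (subset_insert _ _), hI, by grind⟩
    · refine ⟨insert v I, insert_subset_insert _ hIW,
        hI.insert_of_not_linked hE (fun a ha => hmax a (hIW ha)) (fun h => hv (hIW h)) hvI,
        fun u hu huI => ?_⟩
      exact (hlink u (by grind) (by grind)).mono (subset_insert _ _)

/-- Peel off sparse subsets `k` times; every remaining vertex is linked to each of them in turn. -/
theorem exists_descending_loosePaths (hE : (E : Set (Finset α)).Sized 3) (hTW : Disjoint T W)
    {b : ℕ} (hb : ∀ I ⊆ W, Sparse E T M f g I → #I ≤ b) (k : ℕ) :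
    ∃ W' ⊆ W, #W ≤ #W' + k * b ∧ ∀ v ∈ W', ∀ S, #S + k ≤ M + 1 →
      ∃ x ∈ W, ∃ V, LoosePath E k v x V ∧ V ⊆ insert v (W \ W' ∪ T \ S) ∧ g x = g v ∧
        f x ≤ f v ∧ (k ≠ 0 → f x < f v) := by
  induction k with
  | zero => exact ⟨W, subset_rfl, by simp, fun v hv S _ => ⟨v, hv, {v}, .nil v, by simp⟩⟩
  | succ k ih =>
    obtain ⟨W', hW', hcard, hpath⟩ := ih
    obtain ⟨I, hI, hsparse, hlink⟩ := exists_sparse hE T M f g W'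
    refine ⟨W' \ I, sdiff_subset.trans hW', ?_, fun v hv S hS => ?_⟩
    · have := hb I (hI.trans hW') hsparse
      have := card_sdiff_add_card_eq_card hI
      rw [add_one_mul]
      omega
    · rw [mem_sdiff] at hv
      obtain ⟨a, ha, y, hy, he, hga, hfa⟩ := hlink v hv.1 hv.2 S (by omega)
      obtain ⟨hva, hvy, hay⟩ := ne_of_mem hE he
      obtain ⟨x, hx, V, hP, hV, hgx, hfx, -⟩ := hpath a (hI ha) (insert y S)
        (by have := card_insert_le y S; omega)
      have hvT : v ∉ T := fun h => disjoint_left.1 hTW h (hW' hv.1)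
      have hyV : y ∉ W \ W' := by
        have := @disjoint_left _ T W
        grind
      rw [pair_comm] at he
      exact ⟨x, hx, _, .cons he hP hvy (by grind) (by grind), by grind, hgx.trans hga,
        hfx.trans hfa.le, fun _ => hfx.trans_lt hfa⟩

end Order

variable {l i j : ℕ} {anc : ℕ → α → α}

/-- If all sparse subsets of `W` were small, then a descending path of length `l - 2 * (i - j)`
would exist, and the link between its ends would close it to a loose cycle. -/
theorem Level.exists_sparse_subset (hL : Level E U M i R L anc)
    (hE : (E : Set (Finset α)).Sized 3) (hcycle : ¬HasLooseCycle E l) (hM : 4 * l ≤ M)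
    (hil : 2 * i < l) (hj : j < i) (hW : W ⊆ L) :
    ∃ I ⊆ W, Sparse E (U \ R) l (anc (j + 1)) (anc j) I ∧ #W ≤ l * #I := by
  by_contra! hcon
  have hWpos : 0 < #W := by simpa using hcon ∅ (by simp) ⟨by simp, by simp [tips]⟩
  have hdisj : Disjoint (U \ R) W := disjoint_sdiff_self_left.mono_right (hW.trans hL.subset)
  classical
  let := linearOrderOfSTO (WellOrderingRel (α := α))
  let b := (#W - 1) / l
  have hb : ∀ I ⊆ W, Sparse E (U \ R) l (anc (j + 1)) (anc j) I → #I ≤ b := fun I hI hsparse => by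
    rw [Nat.le_div_iff_mul_le (by omega), mul_comm]
    exact Nat.le_sub_one_of_lt (hcon I hI hsparse)
  obtain ⟨W', hW', hcard, hpath⟩ :=
    exists_descending_loosePaths (f := anc (j + 1)) hE hdisj hb (l - 2 * (i - j))
  have hkb : (l - 2 * (i - j)) * b < #W := by
    have := Nat.mul_le_mul_right b (Nat.sub_le l (2 * (i - j)))
    have : l * b ≤ #W - 1 := Nat.mul_div_le _ _
    omega
  obtain ⟨v, hv⟩ : W'.Nonempty := card_pos.1 (by omega)
  obtain ⟨x, hx, V, hP, hV, hgx, -, hfx⟩ := hpath v hv ∅ (by simp; omega)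
  have hne : anc (j + 1) x ≠ anc (j + 1) v := (hfx (by omega)).ne
  obtain ⟨V', hP', hV'⟩ := hL.link j hj x (hW hx) v (hW (hW' hv)) hgx hne (V \ {x, v})
    (by
      have := card_le_card (sdiff_subset (s := V) (t := {x, v}))
      have := hP.card_le
      omega)
    (by simp) (by simp) (by grind)
  refine hcycle ?_
  have := hP.hasLooseCycle hP' (by rintro rfl; exact hne rfl) fun z hz hz' => by
    by_contra! h
    exact disjoint_left.1 hV' hz' (by simp [hz, h.1, h.2])
  rwa [Nat.sub_add_cancel (by omega)] at this

theorem Level.exists_indep_classes (hL : Level E U M i R L anc)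
    (hE : (E : Set (Finset α)).Sized 3) (hcycle : ¬HasLooseCycle E l) (hM : 4 * l ≤ M)
    (hil : 2 * i < l) {t : ℕ} (ht : t ≤ i) :
    ∃ W ⊆ L, #L ≤ l ^ t * #W ∧
      (∀ a ∈ W, ∀ b ∈ W, ∀ c ∈ W, {a, b, c} ∈ E → anc (i - t) a = anc (i - t) b →
        anc (i - t) a ≠ anc (i - t) c) ∧
      #(tips E (U \ R) (fun a b => anc (i - t) a = anc (i - t) b) W) ≤ l * t * l ^ t * #W := by
  induction t with
  | zero =>
    have hself : ∀ a ∈ L, ∀ b ∈ L, ∀ c, {a, b, c} ∈ E → anc (i - 0) a ≠ anc (i - 0) b := by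
      intro a ha b hb c he hab
      rw [Nat.sub_zero, hL.anc_self a ha, hL.anc_self b hb] at hab
      exact (ne_of_mem hE he).1 hab
    refine ⟨L, subset_rfl, by simp,
      fun a ha b hb c _ he hab => absurd hab (hself a ha b hb c he), ?_⟩
    rw [eq_empty_of_forall_notMem (s := tips _ _ _ _), card_empty]
    · exact Nat.zero_le _
    · intro y hy
      obtain ⟨-, a, ha, b, hb, hab, he⟩ := mem_tips.1 hy
      exact hself a ha b hb y he hab
  | succ t ih =>
    obtain ⟨W, hW, hcard, hindep, htips⟩ := ih (by omega)
    rw [show i - t = i - (t + 1) + 1 by omega] at hindep htips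
    obtain ⟨I, hI, hsparse, hWI⟩ := hL.exists_sparse_subset hE hcycle hM hil
      (j := i - (t + 1)) (by omega) hW
    refine ⟨I, hI.trans hW, ?_, fun a ha b hb c hc he hab hac => ?_, ?_⟩
    · calc #L ≤ l ^ t * #W := hcard
        _ ≤ l ^ t * (l * #I) := Nat.mul_le_mul_left _ hWI
        _ = l ^ (t + 1) * #I := by ring
    · exact hindep a (hI ha) b (hI hb) c (hI hc) he (hsparse.eq_of_mem a ha b hb c hc he hab hac)
        (hsparse.eq_of_mem a ha c hc b hb (by rwa [pair_comm]) hac hab)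
    · calc _ ≤ l * t * l ^ t * #W + l * #I :=
            (hsparse.card_tips_le_add hI).trans (Nat.add_le_add_right htips _)
        _ ≤ l * t * l ^ t * (l * #I) + l * #I * l ^ (t + 1) :=
          add_le_add (Nat.mul_le_mul_left _ hWI) (Nat.le_mul_of_pos_right _ (pow_pos (by omega) _))
        _ = l * (t + 1) * l ^ (t + 1) * #I := by ring

theorem Level.exists_indep (hL : Level E U M i R L anc) (hE : (E : Set (Finset α)).Sized 3)
    (hcycle : ¬HasLooseCycle E l) (hM : 4 * l ≤ M) (hil : 2 * i < l) :
    ∃ X ⊆ L, #L ≤ l ^ i * #X ∧ Indep E X ∧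
      #(tips E (U \ R) (fun _ _ => True) X) ≤ l * i * l ^ i * #X := by
  obtain ⟨X, hX, hcard, hindep, htips⟩ := hL.exists_indep_classes hE hcycle hM hil le_rfl
  rw [Nat.sub_self] at hindep htips
  have hanc : ∀ a ∈ X, ∀ b ∈ X, anc 0 a = anc 0 b := fun a ha b hb =>
    hL.anc_zero a (hX ha) b (hX hb)
  refine ⟨X, hX, hcard, fun e he hsub => ?_, (card_le_card fun y hy => ?_).trans htips⟩
  · obtain ⟨a, b, c, -, -, -, rfl⟩ := card_eq_three.1 (hE he)
    simp only [insert_subset_iff, singleton_subset_iff] at hsub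
    obtain ⟨ha, hb, hc⟩ := hsub
    exact hindep a ha b hb c hc he (hanc a ha b hb) (hanc a ha c hc)
  · obtain ⟨hyT, a, ha, b, hb, -, he⟩ := mem_tips.1 hy
    exact mem_tips.2 ⟨hyT, a, ha, b, hb, hanc a ha b hb, he⟩

end Sparse

/-! ### The first level -/

section FirstLevel

variable {α : Type*} {E A : Finset (Finset α)} {U L : Finset α} {r : α}
  {w : α → α} {l M : ℕ}

theorem exists_free_subset (v : α → α) (Y : Finset α) (hv : ∀ y ∈ Y, v y ≠ y) :
    ∃ Z ⊆ Y, #Y ≤ 3 * #Z ∧ ∀ y ∈ Z, ∀ y' ∈ Z, y ≠ v y' := by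
  classical
  induction Y using Finset.strongInduction with
  | H Y ih =>
  rcases Y.eq_empty_or_nonempty with rfl | hne
  · exact ⟨∅, by simp⟩
  obtain ⟨z, hz, hfib⟩ := exists_card_fiber_le_of_card_le_mul (f := v) (s := Y) hne
    (mul_one #Y).ge
  let B := {z, v z} ∪ {y ∈ Y | v y = z}
  have hB : #B ≤ 3 := (card_union_le _ _).trans (add_le_add card_le_two hfib)
  have hzB : z ∈ B := mem_union_left _ (mem_insert_self _ _)
  obtain ⟨Z, hZ, hcard, hfree⟩ := ih (Y \ B)
    ((ssubset_iff_of_subset sdiff_subset).2 ⟨z, hz, fun h => (mem_sdiff.1 h).2 hzB⟩)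
    (fun y hy => hv y (mem_sdiff.1 hy).1)
  have hZB : ∀ y ∈ Z, y ∈ Y ∧ y ∉ B := fun y hy => mem_sdiff.1 (hZ hy)
  refine ⟨insert z Z, insert_subset hz fun y hy => (hZB y hy).1, ?_, ?_⟩
  · rw [card_insert_of_notMem fun h => (hZB z h).2 hzB]
    have := le_card_sdiff B Y
    omega
  · have := hv z hz
    simp only [B, mem_union, mem_insert, mem_singleton, mem_filter] at hZB
    grind

variable [DecidableEq α]

theorem exists_loosePath_two_of_lt_codegree (hE : (E : Set (Finset α)).Sized 3) {c x x' : α}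
    (hcx : c ≠ x) (hcx' : c ≠ x') (hxx' : x ≠ x') {S : Finset α}
    (hx : #S + 1 < codegree E {c, x}) (hx' : #S + 2 < codegree E {c, x'}) (hxS : x ∉ S)
    (hx'S : x' ∉ S) (hcS : c ∉ S) : ∃ V, LoosePath E 2 x x' V ∧ Disjoint V S := by
  obtain ⟨a, ha, hxa⟩ := exists_third_of_card_lt_codegree hE hcx
    ((card_insert_le x' S).trans_lt hx)
  obtain ⟨b, hb, hxb⟩ := exists_third_of_card_lt_codegree hE hcx' (S := {a, x} ∪ S) (by
    have := card_union_le {a, x} S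
    have := card_le_two (a := a) (b := x)
    omega)
  obtain ⟨-, hca, hxa'⟩ := ne_of_mem hE hxa
  obtain ⟨-, hcb, hxb'⟩ := ne_of_mem hE hxb
  rw [triple_rotate] at hxa
  rw [pair_comm] at hxb
  exact ⟨_, .cons hxa (.single hxb (by grind) (by grind) (by grind)) hxa' (by grind) (by grind),
    by simp only [disjoint_insert_left, disjoint_singleton_left]; grind⟩

theorem Level.of_lt_codegree (hE : (E : Set (Finset α)).Sized 3) (hEU : ∀ e ∈ E, e ⊆ U)
    (hL : L.Nonempty) (hedge : ∀ y ∈ L, {r, w y, y} ∈ E) (hyw : ∀ y ∈ L, ∀ y' ∈ L, y ≠ w y')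
    (hcodeg : ∀ y ∈ L, M < codegree E {w y, y}) :
    Level E U M 1 (L ∪ insert r (L.image w)) L fun k x => if k = 0 then r else x where
  subset := subset_union_left
  subset_univ := by
    have hsub : ∀ y ∈ L, {r, w y, y} ⊆ U := fun y hy => hEU _ (hedge y hy)
    obtain ⟨y, hy⟩ := hL
    have := hsub y hy
    grind
  anc_zero := by simp
  anc_self := by simp
  link := by
    intro j hj x hx x' hx' _ hne S hS hxS hx'S hSR
    obtain rfl : j = 0 := by omega
    replace hne : x ≠ x' := by simpa using hne
    obtain ⟨hrw, hrx, hwx⟩ := ne_of_mem hE (hedge x hx)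
    obtain ⟨hrw', hrx', hwx'⟩ := ne_of_mem hE (hedge x' hx')
    have hwS : ∀ y ∈ L, w y ∉ S := fun y hy hyS =>
      hyw _ (hSR (mem_inter.2 ⟨hyS, by grind⟩)) y hy rfl
    by_cases hww : w x = w x'
    · exact exists_loosePath_two_of_lt_codegree hE hwx (hww ▸ hwx') hne
        (by have := hcodeg x hx; omega) (by have := hcodeg x' hx'; rw [hww]; omega) hxS hx'S
        (hwS x hx)
    · have hrS : r ∉ S := fun h => by
        have := ne_of_mem hE (hedge r (hSR (mem_inter.2 ⟨h, by grind⟩)))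
        exact this.2.1 rfl
      have hx₁ := hedge x hx
      rw [triple_reverse] at hx₁
      have := hwS x hx
      have := hwS x' hx'
      have := hyw x hx x' hx'
      have := hyw x' hx' x hx
      exact ⟨_, .cons hx₁ (.single (hedge x' hx') hrw' hrx' hwx') hwx.symm (by grind) (by grind),
        by simp only [disjoint_insert_left, disjoint_singleton_left]; grind⟩

theorem exists_level_one_of_lt_codegree (hE : (E : Set (Finset α)).Sized 3)
    (hEU : ∀ e ∈ E, e ⊆ U) {p : Finset α → Finset α} {N : ℕ} (hp : ∀ q, #{e ∈ E | p e = q} ≤ N)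
    (hA : A ⊆ E) (hAne : A.Nonempty)
    (h : ∀ e ∈ A, ∃ v y, e = {r, v, y} ∧ p e = {r, y} ∧ M < codegree E {v, y}) :
    ∃ R L anc, Level E U M 1 R L anc ∧ #R ≤ 3 * #L ∧ #A ≤ 3 * N * #L := by
  have : Nonempty α := ⟨r⟩
  choose! v y he hpe hcodeg using h
  have hcard : #A ≤ N * #(A.image y) := by
    refine card_le_mul_card_image A N fun z _ => (card_le_card fun e hez => ?_).trans (hp {r, z})
    rw [mem_filter] at hez ⊢
    exact ⟨hA hez.1, by rw [hpe e hez.1, hez.2]⟩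
  have hex : ∀ z ∈ A.image y, ∃ u, {r, u, z} ∈ E ∧ M < codegree E {u, z} := by
    simp only [forall_mem_image]
    exact fun e heA => ⟨v e, he e heA ▸ hA heA, hcodeg e heA⟩
  choose! u huE hu using hex
  obtain ⟨L, hL, hLcard, hfree⟩ := exists_free_subset u (A.image y)
    fun z hz => (ne_of_mem hE (huE z hz)).2.2
  have hLpos : 0 < #L := by
    have := (hAne.image y).card_pos
    omega
  refine ⟨_, L, _, .of_lt_codegree hE hEU (card_pos.1 hLpos) (fun z hz => huE z (hL hz)) hfree
    (fun z hz => hu z (hL hz)), ?_, ?_⟩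
  · have := card_union_le L (insert r (L.image u))
    have := card_insert_le r (L.image u)
    have := card_image_le (s := L) (f := u)
    omega
  · calc #A ≤ N * #(A.image y) := hcard
      _ ≤ N * (3 * #L) := Nat.mul_le_mul_left _ hLcard
      _ = 3 * N * #L := by ring

theorem exists_pendantFamily_of_card_filter_mem_le (hA : (A : Set (Finset α)).Sized 3)
    (hAU : ∀ e ∈ A, e ⊆ U) (hr : ∀ e ∈ A, r ∈ e) {N : ℕ} (hN : ∀ z ≠ r, #{e ∈ A | z ∈ e} ≤ N) :
    ∃ L π w, PendantFamily A (U \ {r}) {r} L π w ∧ #A ≤ 2 * N * #L := by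
  obtain ⟨L, π, w, hP, hmax⟩ := exists_maximal_pendantFamily A (U \ {r}) {r}
  refine ⟨L, π, w, hP, ?_⟩
  have hsub : A ⊆ (L ∪ L.image w).biUnion fun z => {e ∈ A | z ∈ e} := by
    intro e he
    obtain ⟨b, c, rfl⟩ := exists_eq_triple_of_mem (hA he) (hr e he)
    obtain ⟨hrb, hrc, hbc⟩ := ne_of_mem hA he
    have hbcr : {b, c, r} ∈ A := by rwa [← triple_rotate]
    have := hAU _ he
    have := hmax b (by grind) c (by grind) r (mem_singleton_self r) hbc hbcr
    simp only [mem_biUnion, mem_filter]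
    grind
  calc #A ≤ #(L ∪ L.image w) * N := (card_le_card hsub).trans <|
        card_biUnion_le_card_mul _ _ _ fun z hz => hN z (by
          have := hP.mem
          have := hP.mate_mem
          grind)
    _ ≤ (2 * #L) * N := by
      have := card_union_le L (L.image w)
      have := card_image_le (s := L) (f := w)
      gcongr
      omega
    _ = 2 * N * #L := by ring

theorem exists_level_one_of_codegree_le (hE : (E : Set (Finset α)).Sized 3)
    (hEU : ∀ e ∈ E, e ⊆ U) {p : Finset α → Finset α} {N : ℕ} (hp : ∀ q, #{e ∈ E | p e = q} ≤ N)
    (hA : A ⊆ E) (hAne : A.Nonempty)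
    (h : ∀ e ∈ A, ∃ v x, e = {r, v, x} ∧ p e = {r, x} ∧ codegree E {r, v} ≤ N) :
    ∃ R L anc, Level E U M 1 R L anc ∧ #R ≤ 3 * #L ∧ #A ≤ 2 * N * #L := by
  have hdeg : ∀ z ≠ r, #{e ∈ A | z ∈ e} ≤ N := by
    intro z hz
    by_cases hrz : codegree E {r, z} ≤ N
    · refine (card_le_card fun e he => ?_).trans hrz
      rw [mem_filter] at he ⊢
      obtain ⟨v, x, rfl, -⟩ := h e he.1
      exact ⟨hA he.1, by grind⟩
    · refine (card_le_card fun e he => ?_).trans (hp {r, z})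
      rw [mem_filter] at he ⊢
      obtain ⟨v, x, rfl, hpe, hrv⟩ := h e he.1
      have : z = x := by grind
      exact ⟨hA he.1, this ▸ hpe⟩
  have hr : ∀ e ∈ A, r ∈ e := fun e he => by
    obtain ⟨v, x, rfl, -⟩ := h e he
    exact mem_insert_self _ _
  obtain ⟨L, π, w, hP, hcard⟩ := exists_pendantFamily_of_card_filter_mem_le
    (hE.mono (coe_subset.2 hA)) (fun e he => hEU e (hA he)) hr hdeg
  have hLpos : 0 < #L := Nat.pos_of_ne_zero fun h0 => by
    have := hAne.card_pos
    rw [h0] at hcard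
    omega
  obtain ⟨e, he⟩ := hAne
  refine ⟨_, L, _, .succ hE (.zero (hEU e (hA he) (hr e he)))
    { hP with edge := fun y hy => hA (hP.edge y hy) }, ?_, hcard⟩
  have := card_union_le ({r} ∪ L) (L.image w)
  have := card_union_le {r} L
  have := card_image_le (s := L) (f := w)
  have := card_singleton r
  omega

theorem exists_level_one {D : ℕ} (hE : (E : Set (Finset α)).Sized 3) (hEU : ∀ e ∈ E, e ⊆ U)
    (hl : 3 ≤ l) (hcycle : ¬HasLooseCycle E l) (hM : 2 * l ≤ M) (hD : D ^ 2 * #U < 2 * #E) :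
    ∃ R L anc, Level E U M 1 R L anc ∧ #R ≤ 3 * #L ∧ 0 < #L ∧ D ^ 2 ≤ 12 * M * #L := by
  classical
  obtain ⟨p, hp, hpq⟩ := exists_charging hE hl hcycle
  replace hpq : ∀ q, #{e ∈ E | p e = q} ≤ M := fun q => (hpq q).trans hM
  let A : α → Finset (Finset α) := fun r =>
    {e ∈ E | ∃ v y, e = {r, v, y} ∧ p e = {r, y} ∧ M < codegree E {v, y}}
  let B : α → Finset (Finset α) := fun r =>
    {e ∈ E | ∃ v x, e = {r, v, x} ∧ p e = {r, x} ∧ codegree E {r, v} ≤ M}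
  have hcover : E ⊆ U.biUnion fun r => A r ∪ B r := by
    intro e he
    obtain ⟨hpe, hpc⟩ := hp e he
    obtain ⟨x, y, hxy, hpxy⟩ := card_eq_two.1 hpc
    obtain ⟨v, rfl⟩ := eq_triple_of_pair_subset (hE he) hxy (hpxy ▸ hpe)
    have hU := hEU _ he
    simp only [mem_biUnion, mem_union, A, B, mem_filter]
    rcases lt_or_ge M (codegree E {v, y}) with hvy | hvy
    · exact ⟨x, hU (by simp), .inl ⟨he, v, y, by rw [pair_comm], hpxy, hvy⟩⟩
    · exact ⟨y, hU (by simp), .inr ⟨he, v, x, triple_rotate _ _ _, by rw [hpxy, pair_comm],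
        by rwa [pair_comm]⟩⟩
  have hsum : #E ≤ ∑ r ∈ U, (#(A r) + #(B r)) :=
    (card_le_card hcover).trans (card_biUnion_le.trans (sum_le_sum fun r _ => card_union_le _ _))
  obtain ⟨r, -, hr⟩ : ∃ r ∈ U, D ^ 2 < 2 * (#(A r) + #(B r)) := by
    refine exists_lt_of_sum_lt ?_
    rw [sum_const, smul_eq_mul, ← mul_sum]
    linarith
  suffices h : ∃ R L anc, Level E U M 1 R L anc ∧ #R ≤ 3 * #L ∧ #(A r) + #(B r) ≤ 6 * M * #L by
    obtain ⟨R, L, anc, hL, hR, hc⟩ := h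
    exact ⟨R, L, anc, hL, hR, Nat.pos_of_ne_zero fun h0 => by rw [h0] at hc; omega, by linarith⟩
  rcases le_total #(B r) #(A r) with hBA | hAB
  · obtain ⟨R, L, anc, hL, hR, hc⟩ := exists_level_one_of_lt_codegree hE hEU hpq (A := A r)
      (filter_subset _ _) (card_pos.1 (by omega)) (fun e he => (mem_filter.1 he).2)
    exact ⟨R, L, anc, hL, hR, by linarith⟩
  · obtain ⟨R, L, anc, hL, hR, hc⟩ := exists_level_one_of_codegree_le hE hEU hpq (A := B r)
      (filter_subset _ _) (card_pos.1 (by omega)) (fun e he => (mem_filter.1 he).2)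
    exact ⟨R, L, anc, hL, hR, by linarith⟩

end FirstLevel

/-! ### Growing the forest in an expanding triple system -/

section Growth

variable {α : Type*} [DecidableEq α] {E : Finset (Finset α)} {U R V X : Finset α} {l m i D : ℕ}

/-- An expansion property of the triple system `E` on the vertex set `U`: if a superset `T` of `X`
is at most `D` times as large as `X`, then some edge leads from `X` out of `T`, in the sense that it
meets `X` and is otherwise disjoint from `T \ X`. -/
def Expands (E : Finset (Finset α)) (U : Finset α) (D : ℕ) : Prop :=
  ∀ X ⊆ U, X.Nonempty → ∀ T ⊆ U, X ⊆ T → #T ≤ D * #X →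
    ∃ e ∈ E, e ⊆ X ∪ U \ T ∧ ¬Disjoint e X

/-- `T` contains `S`, has at most `D * #S` vertices, and separates `S` from the rest of `V`. -/
structure Blocks (E : Finset (Finset α)) (V : Finset α) (D : ℕ) (S T : Finset α) : Prop where
  subset : S ⊆ T
  subset_univ : T ⊆ V
  card_le : #T ≤ D * #S
  disjoint : ∀ e ∈ E, e ⊆ S ∪ V \ T → Disjoint e S

variable {S T S' T' : Finset α}

theorem Blocks.indep (h : Blocks E V D S T) (hE : (E : Set (Finset α)).Sized 3) : Indep E S := by
  intro e he heS
  have h0 : e = ∅ := disjoint_self_iff_empty e |>.1 <|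
    (h.disjoint e he (heS.trans subset_union_left)).mono_right heS
  simpa [h0] using hE he

theorem Blocks.union (h : Blocks E V D S T) (hST' : S' ⊆ T') (hT' : T' ⊆ V \ T)
    (hcard : #T' ≤ D * #S')
    (hdisj : ∀ e ∈ E, e ⊆ V \ T → e ⊆ S' ∪ (V \ T) \ T' → Disjoint e S') :
    Blocks E V D (S ∪ S') (T ∪ T') where
  subset := union_subset_union h.subset hST'
  subset_univ := union_subset h.subset_univ (hT'.trans sdiff_subset)
  card_le := by
    have hSS' : Disjoint S S' :=
      disjoint_sdiff_self_right.mono h.subset (hST'.trans hT')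
    rw [card_union_of_disjoint hSS', mul_add]
    exact (card_union_le _ _).trans (add_le_add h.card_le hcard)
  disjoint := by
    intro e he hsub
    have heS : Disjoint e S := h.disjoint e he (by grind)
    have heS' : ∀ z ∈ e, z ∉ S := fun z hz => disjoint_left.1 heS hz
    exact disjoint_union_right.2 ⟨heS, hdisj e he (by grind) (by grind)⟩

/-- Take `S` maximal among the sets that can be blocked. If its blocking set covers less than
half of `V`, the rest expands, since any set that can be blocked there could be added to `S`. -/
theorem exists_indep_or_expands (hE : (E : Set (Finset α)).Sized 3) (V : Finset α) (D : ℕ) :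
    (∃ S ⊆ V, Indep E S ∧ #V ≤ 2 * D * #S) ∨
      ∃ U ⊆ V, #V ≤ 2 * #U ∧ Expands {e ∈ E | e ⊆ U} U D := by
  classical
  obtain ⟨⟨S, T⟩, hST, hmax⟩ := exists_max_image
    {q ∈ V.powerset ×ˢ V.powerset | Blocks E V D q.1 q.2} (fun q => #q.1)
    ⟨(∅, ∅), by simpa using ⟨by simp, by simp, by simp, by simp⟩⟩
  replace hST : Blocks E V D S T := (mem_filter.1 hST).2
  have hmax' : ∀ S' T', Blocks E V D S' T' → #S' ≤ #S := fun S' T' h =>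
    hmax (S', T') (mem_filter.2 ⟨mem_product.2 ⟨mem_powerset.2 (h.subset.trans h.subset_univ),
      mem_powerset.2 h.subset_univ⟩, h⟩)
  have hcard := card_sdiff_add_card_eq_card hST.subset_univ
  by_cases hT : #V ≤ 2 * #T
  · exact .inl ⟨S, hST.subset.trans hST.subset_univ, hST.indep hE,
      hT.trans (by rw [mul_assoc]; exact Nat.mul_le_mul_left 2 hST.card_le)⟩
  · refine .inr ⟨V \ T, sdiff_subset, by omega, fun X hX hXne T' hT' hXT' hT'card => ?_⟩
    by_contra! hcon
    have := hmax' _ _ (hST.union hXT' hT' hT'card fun e he heV =>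
      hcon e (mem_filter.2 ⟨he, heV⟩))
    rw [card_union_of_disjoint (disjoint_sdiff_self_right.mono hST.subset hX)] at this
    have := hXne.card_pos
    omega

theorem Expands.exists_pendantFamily (h : Expands E U D) (hE : (E : Set (Finset α)).Sized 3)
    (hRU : R ⊆ U) (hXR : X ⊆ R) (hX : X.Nonempty) (hind : Indep E X) :
    ∃ L π w, PendantFamily E (U \ R) X L π w ∧
      D * #X < #R + #(tips E (U \ R) (fun _ _ => True) X) + 2 * #L := by
  obtain ⟨L, π, w, hP, hmax⟩ := exists_maximal_pendantFamily E (U \ R) X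
  refine ⟨L, π, w, hP, ?_⟩
  by_contra! hcon
  set Y := tips E (U \ R) (fun _ _ => True) X
  have hY : ∀ y, y ∈ Y ↔ y ∈ U \ R ∧ ∃ a ∈ X, ∃ b ∈ X, {a, b, y} ∈ E := by simp [Y, mem_tips]
  obtain ⟨e, he, hsub, hdisj⟩ := h X (hXR.trans hRU) hX (R ∪ Y ∪ (L ∪ L.image w)) (by
      have := hP.mem
      have := hP.mate_mem
      grind) (by grind) (by
      have := card_union_le (R ∪ Y) (L ∪ L.image w)
      have := card_union_le R Y
      have := card_union_le L (L.image w)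
      have := card_image_le (s := L) (f := w)
      omega)
  obtain ⟨z, hze, hzX⟩ := not_disjoint_iff.1 hdisj
  obtain ⟨b, c, rfl⟩ := exists_eq_triple_of_mem (hE he) hze
  have hzcb : {z, c, b} ∈ E := by rwa [pair_comm]
  have hbcz : {b, c, z} ∈ E := by rwa [← triple_rotate]
  have hbc := (ne_of_mem hE he).2.2
  have hout : ∀ y ∈ ({z, b, c} : Finset α), y ∉ X → y ∈ U \ R ∧ y ∉ Y ∧ y ∉ L ∪ L.image w := by
    grind
  by_cases hbX : b ∈ X <;> by_cases hcX : c ∈ X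
  · exact hind _ he (by simp [insert_subset_iff, *])
  · obtain ⟨hcU, hcY, -⟩ := hout c (by simp) hcX
    exact hcY ((hY c).2 ⟨hcU, z, hzX, b, hbX, he⟩)
  · obtain ⟨hbU, hbY, -⟩ := hout b (by simp) hbX
    exact hbY ((hY b).2 ⟨hbU, z, hzX, c, hcX, hzcb⟩)
  · obtain ⟨hbU, -, hbL⟩ := hout b (by simp) hbX
    obtain ⟨hcU, -, hcL⟩ := hout c (by simp) hcX
    exact (hmax b hbU c hcU z hzX hbc hbcz).elim hbL hcL

/-- The constant in the size bound for the level of depth `i + 1`, for forbidden cycle length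
`l`. -/
def levelConst (l : ℕ) : ℕ → ℕ
  | 0 => 48 * l
  | i + 1 => 6 + 4 * ((levelConst l i + l * (i + 1)) * l ^ (i + 1))

theorem Level.exists_succ {L : Finset α} {anc : ℕ → α → α} {M K c : ℕ}
    (hL : Level E U M i R L anc) (hE : (E : Set (Finset α)).Sized 3)
    (hcycle : ¬HasLooseCycle E l) (hM : 4 * l ≤ M) (hil : 2 * i < l) (hexp : Expands E U D)
    (hR : #R ≤ K * #L) (hpos : 0 < #L) (hKD : 4 * ((K + l * i) * l ^ i) ≤ D) (hc : c ≤ K * #L) :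
    ∃ R' L' anc', Level E U M (i + 1) R' L' anc' ∧ #R' ≤ 6 * #L' ∧ 0 < #L' ∧
      D * c ≤ 4 * (K * l ^ i) * #L' := by
  obtain ⟨X, hXL, hLX, hX, htips⟩ := hL.exists_indep hE hcycle hM hil
  have hXpos : 0 < #X := Nat.pos_of_ne_zero fun h0 => by rw [h0] at hLX; omega
  obtain ⟨L', π, w, hP, hDX⟩ := hexp.exists_pendantFamily hE hL.subset_univ
    (hXL.trans hL.subset) (card_pos.1 hXpos) hX
  have hRX : #R ≤ K * (l ^ i * #X) := hR.trans (Nat.mul_le_mul_left _ hLX)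
  have hsmall : 4 * (K * (l ^ i * #X) + l * i * l ^ i * #X) ≤ D * #X :=
    calc _ = 4 * ((K + l * i) * l ^ i) * #X := by ring
      _ ≤ _ := Nat.mul_le_mul_right _ hKD
  have hDX' : D * #X ≤ 4 * #L' := by omega
  refine ⟨_, L', _, hL.succ hE { hP with parent_mem := fun y hy => hXL (hP.parent_mem y hy) },
    ?_, by omega, ?_⟩
  · have := card_union_le (R ∪ L') (L'.image w)
    have := card_union_le R L'
    have := card_image_le (s := L') (f := w)
    omega
  · calc D * c ≤ D * (K * (l ^ i * #X)) :=
          Nat.mul_le_mul_left _ (hc.trans (Nat.mul_le_mul_left _ hLX))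
      _ = K * l ^ i * (D * #X) := by ring
      _ ≤ K * l ^ i * (4 * #L') := Nat.mul_le_mul_left _ hDX'
      _ = 4 * (K * l ^ i) * #L' := by ring

theorem exists_level (hE : (E : Set (Finset α)).Sized 3) (hEU : ∀ e ∈ E, e ⊆ U) (hl : 3 ≤ l)
    (hcycle : ¬HasLooseCycle E l) (hexp : Expands E U D) (hD : D ^ 2 * #U < 2 * #E)
    (hil : 2 * i < l) (hKD : levelConst l i ≤ D) :
    ∃ R L anc, Level E U (4 * l) (i + 1) R L anc ∧ #R ≤ levelConst l i * #L ∧ 0 < #L ∧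
      D ^ (i + 2) ≤ levelConst l i * #L := by
  induction i with
  | zero =>
    obtain ⟨R, L, anc, hL, hR, hpos, hc⟩ :=
      exists_level_one hE hEU hl hcycle (show 2 * l ≤ 4 * l by omega) hD
    rw [← mul_assoc] at hc
    exact ⟨R, L, anc, hL, hR.trans (Nat.mul_le_mul_right _ (by simp [levelConst]; omega)), hpos, hc⟩
  | succ i ih =>
    have hle : levelConst l i ≤ (levelConst l i + l * (i + 1)) * l ^ (i + 1) :=
      (Nat.le_add_right _ _).trans (Nat.le_mul_of_pos_right _ (pow_pos (by omega) _))
    rw [levelConst] at hKD ⊢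
    obtain ⟨R, L, anc, hL, hR, hpos, hc⟩ := ih (by omega) (by omega)
    obtain ⟨R', L', anc', hL', hR', hpos', hc'⟩ :=
      hL.exists_succ hE hcycle le_rfl hil hexp hR hpos (by omega) hc
    refine ⟨R', L', anc', hL', hR'.trans (Nat.mul_le_mul_right _ (by omega)), hpos', ?_⟩
    calc D ^ (i + 1 + 2) = D * D ^ (i + 2) := by ring
      _ ≤ 4 * (levelConst l i * l ^ (i + 1)) * #L' := hc'
      _ ≤ 4 * ((levelConst l i + l * (i + 1)) * l ^ (i + 1)) * #L' := by gcongr; omega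
      _ ≤ _ := Nat.mul_le_mul_right _ (by omega)

theorem exists_indep_of_not_hasLooseCycle (hE : (E : Set (Finset α)).Sized 3)
    (hcycle : ¬HasLooseCycle E l) (hml : 2 * (m + 1) < l) (V : Finset α) (hDpos : 0 < D)
    (hKD : levelConst l m ≤ D) :
    ∃ S ⊆ V, Indep E S ∧
      (#V ≤ 4 * D * #S ∨ D ^ (m + 2) ≤ levelConst l m * l ^ (m + 1) * #S) := by
  obtain ⟨S, hS, hind, hc⟩ | ⟨U, hUV, hcard, hexp⟩ := exists_indep_or_expands hE V D
  · exact ⟨S, hS, hind, .inl (hc.trans (Nat.mul_le_mul_right _ (by omega)))⟩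
  have hFE : {e ∈ E | e ⊆ U} ⊆ E := filter_subset _ _
  have hF : (({e ∈ E | e ⊆ U} : Finset (Finset α)) : Set (Finset α)).Sized 3 :=
    hE.mono (coe_subset.2 hFE)
  have hind_of : ∀ S ⊆ U, Indep {e ∈ E | e ⊆ U} S → Indep E S := fun S hS h e he heS =>
    h e (mem_filter.2 ⟨he, heS.trans hS⟩) heS
  have hcycleF : ¬HasLooseCycle {e ∈ E | e ⊆ U} l := fun h => hcycle (h.mono hFE)
  rcases lt_or_ge (D ^ 2 * #U) (2 * #{e ∈ E | e ⊆ U}) with hdense | hsparse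
  · obtain ⟨R, L, anc, hL, -, -, hc⟩ := exists_level (i := m) hF
      (fun e he => (mem_filter.1 he).2) (by omega) hcycleF hexp hdense (by omega) hKD
    obtain ⟨X, hXL, hLX, hX, -⟩ := hL.exists_indep hF hcycleF le_rfl hml
    have hXU : X ⊆ U := hXL.trans (hL.subset.trans hL.subset_univ)
    refine ⟨X, hXU.trans hUV, hind_of X hXU hX, .inr ?_⟩
    calc D ^ (m + 2) ≤ levelConst l m * #L := hc
      _ ≤ levelConst l m * (l ^ (m + 1) * #X) := Nat.mul_le_mul_left _ hLX
      _ = _ := (mul_assoc _ _ _).symm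
  · obtain ⟨S, hS, hind, hc⟩ := exists_indep_of_two_mul_card_le hF hDpos hsparse
    refine ⟨S, hS.trans hUV, hind_of S hS hind, .inl ?_⟩
    calc #V ≤ 2 * #U := hcard
      _ ≤ 2 * (2 * D * #S) := Nat.mul_le_mul_left _ hc
      _ = 4 * D * #S := by ring

end Growth

/-! ### Hypergraphs and Ramsey numbers -/

theorem pow_le_mul_of_floor {x : ℝ} {n s C k : ℕ} (hx : 1 ≤ x) (hxn : x ^ (k + 1) = n)
    (h : ⌊x⌋₊ < C ∧ 1 ≤ s ∨ n ≤ 4 * ⌊x⌋₊ * s ∨ ⌊x⌋₊ ^ k ≤ C * s) :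
    x ^ k ≤ (C ^ k + 4 + 2 ^ k * C) * s := by
  have hfloor : (⌊x⌋₊ : ℝ) ≤ x := Nat.floor_le (by linarith)
  have hlt : x < ⌊x⌋₊ + 1 := Nat.lt_floor_add_one x
  have hpos : (1 : ℝ) ≤ ⌊x⌋₊ := by exact_mod_cast Nat.floor_pos.2 hx
  have hCk : (0 : ℝ) ≤ C ^ k * s := by positivity
  have hCs : (0 : ℝ) ≤ 2 ^ k * C * s := by positivity
  rw [add_mul, add_mul]
  rcases h with ⟨hC, hs⟩ | hn | hk
  · have hxC : x ≤ C := hlt.le.trans (by exact_mod_cast hC)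
    have hs' : (1 : ℝ) ≤ s := by exact_mod_cast hs
    calc x ^ k ≤ (C : ℝ) ^ k := by gcongr
      _ ≤ C ^ k * s := le_mul_of_one_le_right (by positivity) hs'
      _ ≤ _ := by linarith
  · have hn' : (n : ℝ) ≤ 4 * ⌊x⌋₊ * s := by exact_mod_cast hn
    have hmul : x * x ^ k ≤ x * (4 * s) :=
      calc x * x ^ k = n := by rw [← hxn]; ring
        _ ≤ 4 * x * s := hn'.trans (by gcongr)
        _ = x * (4 * s) := by ring
    linarith [le_of_mul_le_mul_left hmul (by linarith)]
  · have hk' : (⌊x⌋₊ : ℝ) ^ k ≤ C * s := by exact_mod_cast hk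
    calc x ^ k ≤ (2 * ⌊x⌋₊) ^ k := by gcongr; linarith
      _ = 2 ^ k * ⌊x⌋₊ ^ k := mul_pow _ _ _
      _ ≤ 2 ^ k * (C * s) := by gcongr
      _ ≤ _ := by rw [← mul_assoc]; linarith

theorem exists_indep_le_card {l m : ℕ} (hm : 0 < m) (hml : 2 * m < l) :
    ∃ c : ℝ, 0 < c ∧ ∀ {α : Type*} [DecidableEq α] {E : Finset (Finset α)},
      (E : Set (Finset α)).Sized 3 → ¬HasLooseCycle E l → ∀ V : Finset α,
        ∃ S ⊆ V, Indep E S ∧ c * (#V : ℝ) ^ (((m : ℝ) + 1) / ((m : ℝ) + 2)) ≤ #S := by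
  obtain ⟨k, rfl⟩ := Nat.exists_eq_add_of_lt hm
  rw [zero_add] at hml ⊢
  let C := levelConst l k * l ^ (k + 1)
  have hC : levelConst l k ≤ C := Nat.le_mul_of_pos_right _ (pow_pos (by omega) _)
  let B : ℝ := C ^ (k + 2) + 4 + 2 ^ (k + 2) * C
  have hB : 0 < B := by positivity
  refine ⟨B⁻¹, by positivity, fun {α} _ E hE hcycle V => ?_⟩
  simp only [inv_mul_le_iff₀ hB]
  rcases V.eq_empty_or_nonempty with rfl | ⟨v, hv⟩
  · have hexp : (((k + 1 : ℕ) : ℝ) + 1) / ((k + 1 : ℕ) + 2) ≠ 0 := by positivity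
    exact ⟨∅, subset_rfl, fun e he heS => by simpa [subset_empty.1 heS] using hE he,
      by rw [card_empty, Nat.cast_zero, Real.zero_rpow hexp, mul_zero]⟩
  have hV : (1 : ℝ) ≤ #V := by exact_mod_cast card_pos.2 ⟨v, hv⟩
  let x : ℝ := (#V : ℝ) ^ (1 / ((k : ℝ) + 3))
  have hpow (j : ℕ) : x ^ j = (#V : ℝ) ^ ((j : ℝ) / ((k : ℝ) + 3)) := by
    rw [← Real.rpow_natCast, ← Real.rpow_mul (by positivity), one_div_mul_eq_div]
  have hx : 1 ≤ x := Real.one_le_rpow hV (by positivity)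
  have hxV : x ^ (k + 2 + 1) = #V := by
    rw [hpow, show ((k + 2 + 1 : ℕ) : ℝ) = k + 3 by push_cast; ring, div_self (by positivity),
      Real.rpow_one]
  have hgoal : (#V : ℝ) ^ ((((k + 1 : ℕ) : ℝ) + 1) / ((k + 1 : ℕ) + 2)) = x ^ (k + 2) := by
    rw [hpow]
    push_cast
    ring_nf
  rw [hgoal]
  rcases lt_or_ge ⌊x⌋₊ C with hxC | hCx
  · exact ⟨{v}, singleton_subset_iff.2 hv, fun e he heS => by
      simpa [hE he] using card_le_card heS, pow_le_mul_of_floor hx hxV (.inl ⟨hxC, by simp⟩)⟩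
  · obtain ⟨S, hSV, hS, h⟩ := exists_indep_of_not_hasLooseCycle hE hcycle hml V
      (Nat.floor_pos.2 hx) (hC.trans hCx)
    exact ⟨S, hSV, hS, pow_le_mul_of_floor hx hxV (.inr h)⟩

section Hypergraph

variable {α : Type*} {H : Hypergraph α} {E : Finset (Finset α)} {l n r N : ℕ}

theorem exists_finset_forall_mem_iff_mem_edgeSet (hH : H.vertexSet.Finite) :
    ∃ E : Finset (Finset α), ∀ e, e ∈ E ↔ (e : Set α) ∈ H.edgeSet := by
  classical
  refine ⟨{e ∈ hH.toFinset.powerset | (e : Set α) ∈ H.edgeSet}, fun e => ?_⟩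
  simp only [mem_filter, mem_powerset, hH.subset_toFinset, and_iff_right_iff_imp]
  exact fun he => H.subset_vertexSet_of_mem_edgeSet' he

theorem HasLooseCycle.containsLooseCycle [DecidableEq α] (h : HasLooseCycle E l) (hl : 3 ≤ l)
    (hE : ∀ e ∈ E, (e : Set α) ∈ H.edgeSet) (hH : H.IsUniform 3) : H.ContainsLooseCycle l 3 := by
  obtain ⟨e, he, heE⟩ := h.exists_isLooseCycle hl
  refine ⟨e, he, fun i => ?_⟩
  obtain ⟨t, ht, hi⟩ := heE i
  exact hi ▸ ⟨hE t ht, hH _ (hE t ht)⟩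

theorem Indep.isIndependent {S : Finset α} (h : Indep E S)
    (hE : ∀ e : Finset α, (e : Set α) ∈ H.edgeSet → e ∈ E) (hS : (S : Set α) ⊆ H.vertexSet) :
    H.IsIndependent S := by
  refine ⟨hS, fun e he heS => ?_⟩
  lift e to Finset α using S.finite_toSet.subset heS
  exact h e (hE e he) (coe_subset.1 heS)

theorem exists_isIndependent_le_ncard (l m : ℕ) (hl : 3 ≤ l) (hm : m = (l - 1) / 2) :
    ∃ c : ℝ, 0 < c ∧ ∀ (α : Type*) (H : Hypergraph α), H.vertexSet.Finite → H.IsUniform 3 →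
      ¬H.ContainsLooseCycle l 3 → ∃ s : Set α, H.IsIndependent s ∧
        c * (H.vertexSet.ncard : ℝ) ^ (((m : ℝ) + 1) / ((m : ℝ) + 2)) ≤ (s.ncard : ℝ) := by
  obtain ⟨c, hc, h⟩ := exists_indep_le_card (l := l) (m := m) (by omega) (by omega)
  refine ⟨c, hc, fun α H hfin hH hcycle => ?_⟩
  classical
  obtain ⟨E, hE⟩ := exists_finset_forall_mem_iff_mem_edgeSet hfin
  have hsized : (E : Set (Finset α)).Sized 3 := fun e he => by
    exact_mod_cast (Set.encard_coe_eq_coe_finsetCard e).symm.trans (hH _ ((hE e).1 he))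
  obtain ⟨S, hSV, hS, hle⟩ := h hsized
    (fun h => hcycle (h.containsLooseCycle hl (fun e => (hE e).1) hH)) hfin.toFinset
  refine ⟨S, hS.isIndependent (fun e => (hE e).2) (by simpa using coe_subset.2 hSV), ?_⟩
  rwa [Set.ncard_eq_toFinset_card _ hfin, Set.ncard_coe_finset]

theorem ramseyProperty_of_forall_exists_isIndependent
    (h : ∀ H : Hypergraph (Fin N), H.vertexSet = Set.univ → H.IsUniform r →
      ¬H.ContainsLooseCycle l r → ∃ s : Set (Fin N), H.IsIndependent s ∧ n ≤ s.ncard) :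
    Hypergraph.RamseyProperty l n r N := by
  intro col
  refine or_iff_not_imp_left.2 fun hred => ?_
  obtain ⟨s, ⟨-, hs⟩, hn⟩ := h ((Hypergraph.uniformClique N r).colourClass col true) rfl
    (fun e he => he.1) hred
  obtain ⟨t, hts, htn⟩ := Set.exists_subset_card_eq hn
  refine ⟨t, Set.subset_univ _, ?_, fun e he hcard => ⟨hcard, ?_⟩⟩
  · rw [← htn, t.toFinite.cast_ncard_eq]
  · exact (Bool.eq_false_or_eq_true _).resolve_left fun hcol => hs e ⟨hcard, hcol⟩ (he.trans hts)

theorem exists_isRamseyNumber_le (h : Hypergraph.RamseyProperty l n r N) :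
    ∃ R ≤ N, Hypergraph.IsRamseyNumber l n r R :=
  ⟨sInf {N | Hypergraph.RamseyProperty l n r N}, Nat.sInf_le h, Nat.sInf_mem ⟨N, h⟩,
    fun _ => Nat.sInf_le⟩

end Hypergraph

theorem exists_le_mul_rpow_inv_and_le {c d : ℝ} (hc : 0 < c) (hd : 0 < d) :
    ∃ K : ℝ, ∀ n : ℕ, ∃ N : ℕ, (n : ℝ) ≤ c * (N : ℝ) ^ d⁻¹ ∧ (N : ℝ) ≤ K * (n : ℝ) ^ d := by
  refine ⟨c⁻¹ ^ d + 1, fun n => ⟨⌈(c⁻¹ * n) ^ d⌉₊, ?_, ?_⟩⟩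
  · rw [← inv_mul_le_iff₀ hc]
    calc c⁻¹ * n = ((c⁻¹ * n) ^ d) ^ d⁻¹ := (Real.rpow_rpow_inv (by positivity) hd.ne').symm
      _ ≤ _ := by gcongr; exact Nat.le_ceil _
  · rcases n.eq_zero_or_pos with rfl | hn
    · simp [Real.zero_rpow hd.ne']
    have hnd : (1 : ℝ) ≤ (n : ℝ) ^ d := Real.one_le_rpow (by exact_mod_cast hn) hd.le
    calc (⌈(c⁻¹ * n) ^ d⌉₊ : ℝ) ≤ (c⁻¹ * n) ^ d + 1 := (Nat.ceil_lt_add_one (by positivity)).le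
      _ = c⁻¹ ^ d * n ^ d + 1 := by rw [Real.mul_rpow (by positivity) (by positivity)]
      _ ≤ (c⁻¹ ^ d + 1) * n ^ d := by linarith

theorem exists_ramseyNumber_le_mul_rpow (l : ℕ) (hl : 3 ≤ l) :
    ∃ c : ℝ, ∀ n : ℕ, ∃ R : ℕ, Hypergraph.IsRamseyNumber l n 3 R ∧
      (R : ℝ) ≤ c * (n : ℝ) ^ (1 + 1 / (((l + 1) / 2 : ℕ) : ℝ)) := by
  obtain ⟨m, hm⟩ : ∃ m, m = (l - 1) / 2 := ⟨_, rfl⟩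
  obtain ⟨c, hc, hindep⟩ := exists_isIndependent_le_ncard l m hl hm
  let d : ℝ := 1 + 1 / (((l + 1) / 2 : ℕ) : ℝ)
  have hd : ((m : ℝ) + 1) / (m + 2) = d⁻¹ := by
    simp only [d, show (l + 1) / 2 = m + 1 by omega]
    push_cast
    field_simp
    ring
  rw [hd] at hindep
  obtain ⟨K, hK⟩ := exists_le_mul_rpow_inv_and_le hc (d := d) (by positivity)
  refine ⟨K, fun n => ?_⟩
  obtain ⟨N, hnN, hNK⟩ := hK n
  have hN : Hypergraph.RamseyProperty l n 3 N :=
    ramseyProperty_of_forall_exists_isIndependent fun H hV hH hcycle => by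
      obtain ⟨s, hs, hle⟩ := hindep (Fin N) H (Set.toFinite _) hH hcycle
      rw [hV, Set.ncard_univ, Nat.card_fin] at hle
      exact ⟨s, hs, by exact_mod_cast hnN.trans hle⟩
  obtain ⟨R, hRN, hR⟩ := exists_isRamseyNumber_le hN
  exact ⟨R, hR, (Nat.cast_le.2 hRN).trans hNK⟩

end TripleSystem

theorem theorem1p4 :
    (∀ l : ℕ, 3 ≤ l → ∃ c : ℝ, ∀ n : ℕ, ∃ R : ℕ, Hypergraph.IsRamseyNumber l n 3 R ∧
      (R : ℝ) ≤ c * (n : ℝ) ^ (1 + 1 / (((l + 1) / 2 : ℕ) : ℝ))) ∧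
    (∃ c : ℝ, ∀ n : ℕ, ∃ R : ℕ, Hypergraph.IsRamseyNumber 5 n 3 R ∧
      (R : ℝ) ≤ c * (n : ℝ) ^ (4 / 3 : ℝ)) ∧
    (∀ l m : ℕ, 3 ≤ l → m = (l - 1) / 2 → ∃ c : ℝ, 0 < c ∧
      ∀ (α : Type*) (H : Hypergraph α), H.vertexSet.Finite → H.IsUniform 3 →
        ¬ H.ContainsLooseCycle l 3 →
          ∃ s : Set α, H.IsIndependent s ∧
            c * (H.vertexSet.ncard : ℝ) ^ (((m : ℝ) + 1) / ((m : ℝ) + 2)) ≤ (s.ncard : ℝ)) := by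
  refine ⟨TripleSystem.exists_ramseyNumber_le_mul_rpow, ?_,
    TripleSystem.exists_isIndependent_le_ncard⟩
  obtain ⟨c, hc⟩ := TripleSystem.exists_ramseyNumber_le_mul_rpow 5 (by norm_num)
  refine ⟨c, fun n => ?_⟩
  convert hc n using 5
  norm_num
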